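/- Let $\mathbb{K}$ be an algebraically closed field of characteristic $\neq 2$, let $\mathbb{K}[\epsilon]$ ($\epsilon^2=0$) be the ring of dual numbers, let $V$ be a $\mathbb{K}$-vector space of finite dimension $r$, let $V\oplus\epsilon V=V\otimes_{\mathbb{K}}\mathbb{K}[\epsilon]$, and let $\pi:V\oplus\epsilon V\to V$ be the projection. For a $\mathbb{K}[\epsilon]$-module $M$ put $M^{(1)}=\mathrm{im}(\cdot\epsilon)\subset M^{(2)}=\ker(\cdot\epsilon)$. A $\mathbb{K}[\epsilon]$-linear map $\phi:M\to N$ induces $\phi_0:M^{(2)}/M^{(1)}\to N^{(2)}/N^{(1)}$, and $\mathrm{Hom}^0_{\mathbb{K}[\epsilon]}(M,N)$ denotes the set of those $\phi$ with $\phi_0=0$. Varieties carry their reduced structure, and tangent spaces of locally closed subvarieties of a Grassmannian $\mathrm{Gr}(n,W)$ are regarded as subspaces of $T_{[L]}\mathrm{Gr}(n,W)=\mathrm{Hom}_{\mathbb{K}}(L,W/L)$. (1) Let $b_1$ be a non-degenerate symmetric bilinear form on $V$, extended $\mathbb{K}[\epsilon]$-bilinearly to a form $b_2$ on $V\oplus\epsilon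 V$ with values in $\mathbb{K}[\epsilon]$. A $\mathbb{K}[\epsilon]$-submodule $L\subset V\oplus\epsilon V$ is Lagrangian if $b_2$ vanishes on $L$ and $\dim_{\mathbb{K}}L=r$. Let $\mathrm{OGr}(r,V\oplus\epsilon V)$ be the orthogonal Grassmannian of $r$-dimensional $\mathbb{K}$-subspaces that are isotropic for the $\epsilon$-component of $b_2$, let $\mathrm{OGr}^{(0)}$ be its connected component containing $[\epsilon V]$ and $\mathrm{OGr}^{(1)}$ the complement of that component. For $m\in\{0,1\}$ let $\mathrm{O}\Sigma^{(m)}=\{[L]\in\mathrm{OGr}^{(m)}\mid\epsilon L\subset L\}$, which is stratified by the subsets $\mathrm{O}\Sigma_i$ on which $\dim\pi(L)=i$; its largest stratum is the non-empty stratum with the largest index $i$. Let $L$ be a Lagrangian $\mathbb{K}[\epsilon]$-submodule such that $[L]$ lies in the largest stratum of $\mathrm{O}\Sigma^{(m)}$. Then $[L]$ is a smooth point of $\mathrm{O}\Sigma^{(m)}$; the form $b_2$ induces an isomorphism $(V\oplus\epsilon V)/L\cong L^*=\mathrm{Hom}_{\mathbb{K}[\epsilon]}(L,\mathbb{K}[\epsilon])$;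 and under this isomorphism $$T_{[L]}\mathrm{O}\Sigma^{(m)}=\mathrm{Hom}^{0,skew}_{\mathbb{K}[\epsilon]}(L,L^*),$$ the space of skew-symmetric $\mathbb{K}[\epsilon]$-linear maps $\phi:L\to L^*$ with $\phi_0=0$. (2) For integers $n,i\ge 0$ let $\Sigma_i\subset\mathrm{Gr}(n,V\oplus\epsilon V)$ be the set of $[L]$ with $\dim_{\mathbb{K}} L=n$, $\epsilon L\subset L$ and $\dim\pi(L)=i$. Then for every $[L]\in\Sigma_i$ $$T_{[L]}\Sigma_i=\mathrm{Hom}^0_{\mathbb{K}[\epsilon]}(L,(V\oplus\epsilon V)/L).$$ Moreover, the map $(F,G,\varphi)\mapsto\{a+\epsilon b\mid a\in F,\ b\bmod G=\varphi(a)\}$ from the total space of the vector bundle with fibre $\mathrm{Hom}(F,V/G)$ over the variety $\mathrm{Flag}(i,n-i,V)$ of flags $F\subset G\subset V$ with $\dim F=i$, $\dim G=n-i$, to $\mathrm{Gr}(n,V\oplus\epsilon V)$ has image $\Sigma_i$ and is an embedding, i.e. it is injective and an isomorphism onto a locally closed subvariety. -/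

import Mathlib

open scoped TensorProduct

noncomputable section

namespace DualHecke

/-! ### Classical affine varieties inside a vector space -/

section Affine

variable (K : Type*) [Field K] {E E' : Type*} [AddCommGroup E] [Module K E]
  [AddCommGroup E'] [Module K E']

/-- The ring of polynomial functions on a subset `Z` of a vector space `E`: the algebra of
functions on `Z` generated by the restrictions of the linear functionals. For finite-dimensional
`E` this is the polynomial ring of `E` modulo the ideal of all polynomials vanishing on `Z`, that
is, the coordinate ring of the Zariski closure of `Z` with its reduced structure. -/
def coordRing (Z : Set E) : Subalgebra K (Z → K) :=
  Algebra.adjoin K (Set.range fun (l : Module.Dual K E) (z : Z) => l z)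

/-- The restriction of a linear functional to `Z`, as an element of the coordinate ring. -/
def coordRing.linear (Z : Set E) (l : Module.Dual K E) : coordRing K Z :=
  ⟨fun z => l z, Algebra.subset_adjoin ⟨l, rfl⟩⟩

/-- Evaluation of polynomial functions at a point `z` of `Z`. -/
def coordRing.eval {Z : Set E} (z : Z) : coordRing K Z →ₐ[K] K :=
  (Pi.evalAlgHom K (fun _ : Z => K) z).comp (coordRing K Z).val

/-- The maximal ideal of the point `z`. -/
def pointIdeal {Z : Set E} (z : Z) : Ideal (coordRing K Z) :=
  RingHom.ker (coordRing.eval K z)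

instance pointIdeal_isPrime {Z : Set E} (z : Z) : (pointIdeal K z).IsPrime :=
  RingHom.ker_isPrime _

/-- `z` is a smooth point of the (locally closed) subvariety `Z` of the vector space `E`: the
coordinate ring of `Z` is smooth over `K` at `z`. (A locally closed set is open in its closure, so
the local rings of `Z` and of its closure at `z` agree.) -/
def IsSmoothPoint {Z : Set E} (z : Z) : Prop :=
  Algebra.IsSmoothAt K (pointIdeal K z)

/-- The Zariski tangent space at `z` of the (locally closed) subvariety `Z` of `E`, as a subset of
`E`: the vectors `v` such that differentiating linear functionals along `v` extends to a
`K`-derivation at `z` of the coordinate ring of `Z`. -/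
def affineTangentSpace {Z : Set E} (z : Z) : Set E :=
  {v | ∃ D : coordRing K Z →ₗ[K] K,
      (∀ f g, D (f * g) = coordRing.eval K z f * D g + coordRing.eval K z g * D f) ∧
      ∀ l : Module.Dual K E, D (coordRing.linear K Z l) = l v}

variable (E) in
/-- Polynomial functions on a vector space. -/
def polyFun : Subalgebra K (E → K) :=
  Algebra.adjoin K (Set.range fun (l : Module.Dual K E) (x : E) => l x)

/-- Polynomial maps between vector spaces. -/
def IsPolyMap (f : E → E') : Prop :=
  ∀ l : Module.Dual K E', (fun x => l (f x)) ∈ polyFun K E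

variable (E) in
/-- The Zariski topology of a vector space: the complements of the zero sets of the polynomial
functions are a basis. -/
@[reducible] def zariski : TopologicalSpace E :=
  TopologicalSpace.generateFrom {U | ∃ f ∈ polyFun K E, U = {x | f x ≠ 0}}

end Affine

/-! ### Grassmannians

The set `Submodule K W` is the disjoint union of the Grassmannians `Gr(n, W)`. It is covered by
the affine charts `Hom(L, C)`, one for each pair of complementary subspaces `L`, `C`. -/

section Grassmannian

variable (K : Type*) [Field K] (W : Type*) [AddCommGroup W] [Module K W]

variable {K W} in
/-- The affine chart of the Grassmannian attached to complementary subspaces `L`, `C`: a linear map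
`L → C` is sent to its graph. Its image is the set of all complements of `C`, and `0` is sent
to `L`. -/
def grChart (L C : Submodule K W) (φ : L →ₗ[K] C) : Submodule K W :=
  LinearMap.range (L.subtype + C.subtype ∘ₗ φ)

/-- The Zariski topology of the Grassmannians: a set is open if its preimages under all charts
are open. -/
@[reducible] def grTopology : TopologicalSpace (Submodule K W) :=
  ⨆ (L : Submodule K W) (C : Submodule K W) (_ : IsCompl L C),
    TopologicalSpace.coinduced (grChart L C) (zariski K (L →ₗ[K] C))

variable {K W}

/-- `[L]` is a smooth point of the locally closed reduced subvariety `Z` of the Grassmannian: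
`[L]` lies in `Z` and is a smooth point of it in an affine chart centred at `[L]`. (All charts give
the same answer.) -/
def IsGrSmoothPoint (Z : Set (Submodule K W)) (L : Submodule K W) : Prop :=
  ∃ C : Submodule K W, IsCompl L C ∧ ∃ h : (0 : L →ₗ[K] C) ∈ grChart L C ⁻¹' Z,
    IsSmoothPoint K (⟨0, h⟩ : grChart L C ⁻¹' Z)

/-- The Zariski tangent space at `[L]` of the locally closed reduced subvariety `Z` of the
Grassmannian, as a subset of the tangent space `Hom(L, W/L)` of the Grassmannian, computed in an
affine chart `Hom(L, C) ≅ Hom(L, W/L)` centred at `[L]`. (All charts give the same answer.) -/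
def grTangentSpace (Z : Set (Submodule K W)) (L : Submodule K W) : Set (L →ₗ[K] W ⧸ L) :=
  {φ | ∃ C : Submodule K W, IsCompl L C ∧ ∃ h : (0 : L →ₗ[K] C) ∈ grChart L C ⁻¹' Z,
      ∃ φ' ∈ affineTangentSpace K (⟨0, h⟩ : grChart L C ⁻¹' Z),
        φ = L.mkQ ∘ₗ C.subtype ∘ₗ φ'}

end Grassmannian

/-! ### Modules over the dual numbers `K[ε]` -/

section DualNumbers

variable (K : Type*) [Field K]
variable (M N : Type*) [AddCommGroup M] [Module (DualNumber K) M]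
  [AddCommGroup N] [Module (DualNumber K) N]

/-- Multiplication by `ε` on a `K[ε]`-module. -/
def epsMul : M →ₗ[DualNumber K] M :=
  LinearMap.lsmul (DualNumber K) M (DualNumber.eps : DualNumber K)

/-- `M⁽¹⁾`, the image of multiplication by `ε`. -/
def filOne : Submodule (DualNumber K) M := LinearMap.range (epsMul K M)

/-- `M⁽²⁾`, the kernel of multiplication by `ε`. -/
def filTwo : Submodule (DualNumber K) M := LinearMap.ker (epsMul K M)

variable {K M N}

theorem map_mem_filTwo (φ : M →ₗ[DualNumber K] N) (x : M) (hx : x ∈ filTwo K M) :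
    φ x ∈ filTwo K N := by
  simp only [filTwo, epsMul, LinearMap.mem_ker, LinearMap.lsmul_apply] at hx ⊢
  rw [← map_smul, hx, map_zero]

theorem map_mem_filOne (φ : M →ₗ[DualNumber K] N) (x : M) (hx : x ∈ filOne K M) :
    φ x ∈ filOne K N := by
  obtain ⟨y, rfl⟩ := hx
  exact ⟨φ y, by simp [epsMul]⟩

/-- The map `φ₀ : M⁽²⁾/M⁽¹⁾ → N⁽²⁾/N⁽¹⁾` induced by a `K[ε]`-linear map `φ`. -/
def inducedZero (φ : M →ₗ[DualNumber K] N) :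
    (filTwo K M ⧸ (filOne K M).submoduleOf (filTwo K M)) →ₗ[DualNumber K]
      (filTwo K N ⧸ (filOne K N).submoduleOf (filTwo K N)) :=
  Submodule.mapQ _ _ (φ.restrict (map_mem_filTwo φ))
    (fun x hx => map_mem_filOne φ (x : M) hx)

variable (K M N) in
/-- `Hom⁰(M, N)`: the `K[ε]`-linear maps `φ` with `φ₀ = 0`. -/
def homZero : Set (M →ₗ[DualNumber K] N) := {φ | inducedZero φ = 0}

variable (K M) in
/-- `Hom^{0,skew}(M, M*)`: the skew-symmetric `K[ε]`-linear maps `ψ` from `M` to the dual module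
`M* = Hom(M, K[ε])` with `ψ₀ = 0`. -/
def homZeroSkew : Set (M →ₗ[DualNumber K] Module.Dual (DualNumber K) M) :=
  {ψ | (∀ x y, ψ x y = -ψ y x) ∧ inducedZero ψ = 0}

end DualNumbers

/-! ### The module `V ⊕ εV` and its submodules -/

section Submodules

variable (K : Type*) [Field K] (V : Type*) [AddCommGroup V] [Module K V]

/-- `V ⊕ εV = K[ε] ⊗ V`. -/
def DualExt : Type _ := DualNumber K ⊗[K] V

instance : AddCommGroup (DualExt K V) :=
  inferInstanceAs (AddCommGroup (DualNumber K ⊗[K] V))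

instance : Module (DualNumber K) (DualExt K V) :=
  inferInstanceAs (Module (DualNumber K) (DualNumber K ⊗[K] V))

instance : Module K (DualExt K V) :=
  inferInstanceAs (Module K (DualNumber K ⊗[K] V))

instance : IsScalarTower K (DualNumber K) (DualExt K V) :=
  inferInstanceAs (IsScalarTower K (DualNumber K) (DualNumber K ⊗[K] V))

/-- The linear map `V × V → V ⊕ εV` sending `(a, b)` to `a + ε b`. -/
def pairMap : V × V →ₗ[K] DualExt K V :=
  LinearMap.coprod (TensorProduct.mk K (DualNumber K) V 1)
    (TensorProduct.mk K (DualNumber K) V DualNumber.eps)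

/-- The projection `π : V ⊕ εV → V`, sending `a + ε b` to `a`. -/
def projV : DualExt K V →ₗ[K] V :=
  (TensorProduct.lid K V).toLinearMap ∘ₗ
    LinearMap.rTensor V (TrivSqZeroExt.fstHom K K K).toLinearMap

/-- The subspace `εV` of `V ⊕ εV`. -/
def epsV : Submodule K (DualExt K V) :=
  LinearMap.range (TensorProduct.mk K (DualNumber K) V DualNumber.eps)

variable {K V}

/-- A `K`-subspace is stable under `ε`, i.e. is a `K[ε]`-submodule. -/
def IsEpsStable (L : Submodule K (DualExt K V)) : Prop :=
  ∀ x ∈ L, (DualNumber.eps : DualNumber K) • x ∈ L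

/-- The index `dim π(L)` of the stratum containing `L`. -/
def stratumIndex (L : Submodule K (DualExt K V)) : ℕ :=
  Module.finrank K (L.map (projV K V))

variable (K V) in
/-- The stratum `Σ_i` of `Σ = {[L] ∈ Gr(n, V ⊕ εV) | εL ⊆ L}`. -/
def sigmaStratum (n i : ℕ) : Set (Submodule K (DualExt K V)) :=
  {L | Module.finrank K L = n ∧ IsEpsStable L ∧ stratumIndex L = i}

/-- A `K[ε]`-linear map `L → (V ⊕ εV)/L` regarded as a `K`-linear map, i.e. as a tangent vector at
`[L]` of the Grassmannian of `K`-subspaces. -/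
def forgetHom (L : Submodule (DualNumber K) (DualExt K V))
    (φ : L →ₗ[DualNumber K] DualExt K V ⧸ L) :
    L.restrictScalars K →ₗ[K] DualExt K V ⧸ L.restrictScalars K :=
  (Submodule.Quotient.restrictScalarsEquiv K L).symm.toLinearMap ∘ₗ
    (φ.restrictScalars K ∘ₗ
      ((Submodule.restrictScalarsEquiv K (DualNumber K) (DualExt K V) L).restrictScalars
        K).toLinearMap)

end Submodules

/-! ### `Σ_i` as the total space of a vector bundle over a flag variety -/

section FlagBundle

variable (K : Type*) [Field K] (V : Type*) [AddCommGroup V] [Module K V]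

/-- A flag `F ⊆ G ⊆ V` together with a linear map `F → V/G`. -/
structure FlagHom where
  F : Submodule K V
  G : Submodule K V
  le : F ≤ G
  hom : F →ₗ[K] V ⧸ G

/-- The total space of the vector bundle with fibre `Hom(F, V/G)` over the variety
`Flag(i, n - i, V)` of flags with `dim F = i` and `dim G = n - i`. -/
def flagBundle (n i : ℕ) : Set (FlagHom K V) :=
  {x | Module.finrank K x.F = i ∧ Module.finrank K x.G + i = n}

variable {K V}

/-- The map `ι` from the total space to the Grassmannian of `V ⊕ εV`: `(F, G, φ)` is sent to
`{a + ε b | a ∈ F, b mod G = φ(a)}`. -/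
def FlagHom.toSubmodule (x : FlagHom K V) : Submodule K (DualExt K V) :=
  ((LinearMap.eqLocus (x.hom ∘ₗ LinearMap.fst K x.F V) (x.G.mkQ ∘ₗ LinearMap.snd K x.F V)).map
    (LinearMap.prodMap x.F.subtype (LinearMap.id : V →ₗ[K] V))).map (pairMap K V)

/-- The affine space of parameters of the standard local trivialisation of the bundle attached to a
decomposition `V = F ⊕ A ⊕ B`: flags `(F', G')` near `(F, F ⊕ A)` are given by three linear maps
`F → A`, `F → B`, `A → B`, and `Hom(F', V/G')` is identified with `Hom(F, B)`. -/
abbrev BundleParam (F A B : Submodule K V) : Type _ :=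
  (F →ₗ[K] A) × (F →ₗ[K] B) × (A →ₗ[K] B) × (F →ₗ[K] B)

/-- The standard chart of the total space attached to a decomposition `V = F ⊕ A ⊕ B`. To
`(p, q, s, ψ)` it attaches `F' = {f + p f + q f}`, `G' = F' + {a + s a}`, and the composite
`F' ≅ F → B ≅ V/G'` in which the middle map is `ψ` and the outer maps are induced by the
decomposition. -/
def bundleChart (F A B : Submodule K V) (h : IsCompl F (A ⊔ B)) (x : BundleParam F A B) :
    FlagHom K V :=
  let F' : Submodule K V :=
    LinearMap.range (F.subtype + A.subtype ∘ₗ x.1 + B.subtype ∘ₗ x.2.1)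
  let G' : Submodule K V := F' ⊔ LinearMap.range (A.subtype + B.subtype ∘ₗ x.2.2.1)
  { F := F'
    G := G'
    le := le_sup_left
    hom := G'.mkQ ∘ₗ B.subtype ∘ₗ x.2.2.2 ∘ₗ F.projectionOnto (A ⊔ B) h ∘ₗ F'.subtype }

variable (K V) in
/-- The map `ι` is an embedding (an immersion of varieties) of the total space into the
Grassmannian `Gr(n, V ⊕ εV)`, i.e. it is injective and an isomorphism onto a locally closed
subvariety: near each point of the total space there is a chart `U` of the Grassmannian whose
preimage under `ι` is a chart of the total space, and in these two charts `ι` is a closed immersion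
of affine spaces (a polynomial map with a polynomial left inverse). -/
def IsBundleEmbedding (n i : ℕ) : Prop :=
  Set.InjOn FlagHom.toSubmodule (flagBundle K V n i) ∧
  ∀ x ∈ flagBundle K V n i, ∃ (F A B : Submodule K V) (h : IsCompl F (A ⊔ B)) (_ : Disjoint A B),
    x ∈ Set.range (bundleChart F A B h) ∧
    ∃ L C : Submodule K (DualExt K V), IsCompl L C ∧
      Set.range (bundleChart F A B h) =
        {y | y ∈ flagBundle K V n i ∧ y.toSubmodule ∈ Set.range (grChart L C)} ∧
      ∃ (f : BundleParam F A B → (L →ₗ[K] C)) (g : (L →ₗ[K] C) → BundleParam F A B),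
        IsPolyMap K f ∧ IsPolyMap K g ∧ Function.LeftInverse g f ∧
        ∀ u, (bundleChart F A B h u).toSubmodule = grChart L C (f u)

end FlagBundle

/-! ### Lagrangian submodules -/

section Lagrangian

variable {K : Type*} [Field K] {V : Type*} [AddCommGroup V] [Module K V]
variable (b : LinearMap.BilinForm K V)

/-- The `K[ε]`-bilinear extension of the form `b` to `V ⊕ εV`. -/
def extForm : LinearMap.BilinForm (DualNumber K) (DualExt K V) :=
  LinearMap.BilinForm.baseChange (DualNumber K) b

/-- Lagrangian `K[ε]`-submodules of `V ⊕ εV`. -/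
structure IsLagrangian (L : Submodule (DualNumber K) (DualExt K V)) : Prop where
  isotropic : ∀ x ∈ L, ∀ y ∈ L, extForm b x y = 0
  finrank_eq : Module.finrank K L = Module.finrank K V

variable {b} in
/-- For a Lagrangian submodule `L`, the `K[ε]`-linear map `(V ⊕ εV)/L → L*` induced by the form. -/
def IsLagrangian.toDual {L : Submodule (DualNumber K) (DualExt K V)} (hL : IsLagrangian b L) :
    (DualExt K V ⧸ L) →ₗ[DualNumber K] Module.Dual (DualNumber K) L :=
  L.liftQ ((extForm b).domRestrict₂ L) (fun x hx => by
    rw [LinearMap.mem_ker]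
    ext1 y
    exact hL.isotropic x hx y y.2)

/-- The orthogonal Grassmannian `OGr(r, V ⊕ εV)`, `r = dim V`: the `r`-dimensional `K`-subspaces of
the `2r`-dimensional space `V ⊕ εV` which are isotropic for the `K`-valued form
`(a + ε b, a' + ε b') ↦ b(a, b') + b(b, a')`, the `ε`-component of the `K[ε]`-valued form. A
`K[ε]`-submodule is isotropic for either of the two forms if and only if it is for the other. -/
def oGr : Set (Submodule K (DualExt K V)) :=
  {L | Module.finrank K L = Module.finrank K V ∧
    ∀ x ∈ L, ∀ y ∈ L, TrivSqZeroExt.snd (extForm b x y) = 0}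

/-- `OGr^(0)` is the connected component of `[εV]` in `OGr(r, V ⊕ εV)` for the Zariski topology,
`OGr^(1)` is the rest, i.e. the other connected component. -/
def oGrComponent (m : Fin 2) : Set (Submodule K (DualExt K V)) :=
  if m = 0 then @connectedComponentIn _ (grTopology K (DualExt K V)) (oGr b) (epsV K V)
  else oGr b \ @connectedComponentIn _ (grTopology K (DualExt K V)) (oGr b) (epsV K V)

/-- `OΣ^(m) = {[L] ∈ OGr^(m) | εL ⊆ L}`. -/
def oSigma (m : Fin 2) : Set (Submodule K (DualExt K V)) :=
  {L | L ∈ oGrComponent b m ∧ IsEpsStable L}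

/-- The part of `OΣ^(m)` in the stratum `OΣ_i`. -/
def oSigmaStratum (m : Fin 2) (i : ℕ) : Set (Submodule K (DualExt K V)) :=
  {L | L ∈ oSigma b m ∧ stratumIndex L = i}

/-- The largest stratum of `OΣ^(m)`: the non-empty stratum with the largest index. -/
def oSigmaLargestStratum (m : Fin 2) : Set (Submodule K (DualExt K V)) :=
  {L | ∃ i, L ∈ oSigmaStratum b m i ∧ ∀ j, (oSigmaStratum b m j).Nonempty → j ≤ i}

end Lagrangian

end DualHecke

end

open scoped TensorProduct

noncomputable section

namespace DualHecke

/-! ### Polynomial functions and polynomial maps -/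

section PolyMap

variable {K : Type*} [Field K] {E E' E'' : Type*} [AddCommGroup E] [Module K E]
  [AddCommGroup E'] [Module K E'] [AddCommGroup E''] [Module K E'']

/-! An `ε`-stable subspace `L` amounts to `F = π(L)`, `G = {b | εb ∈ L}` with `F ⊆ G`, and a linear
map `F → V/G`. For a decomposition `V = F ⊕ A ⊕ B` with `G = F ⊕ A`, one has `L = {f + ε(ψ₀ f + g +
a)}`, with complement `C = (A ⊕ B) ⊕ εB`. In the chart `Hom(L, C)` the stratum of `L` is the image
of an explicit map `Splitting.mat` of degree two in `(p, q, s, ψ)`, whose left inverse just reads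
off matrix entries (`Splitting.exists_mat_eq`). The same formula describes the bundle chart
(`Splitting.toSubmodule_bundleChart`), so the bundle is embedded.

Tangent spaces are bounded from both sides. A Zariski tangent vector is a point of the coordinate
ring over the dual numbers. Linearising `ε`-stability gives `ε`-linearity of `L → (V ⊕ εV)/L`;
linearising the bound on `dim π(L)`, through vanishing minors, gives `φ₀ = 0`; linearising isotropy
gives skewness. Conversely, these linear conditions force a matrix into the linear part of the
parametrisation (`Splitting.eq_lin_of_isTangent`), and it is then the velocity of a quadratic curve
inside the variety.

In the orthogonal case `G = F^⊥`, and the decomposition can be chosen with `F`, `B` isotropic and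
`A` orthogonal to both. After the substitution `q ↦ q + ½ s p`, isotropy becomes linear in the
parameters. The index `dim π` cannot drop in the chart, so on the largest stratum the whole of
`OΣ^(m)` in the chart is this stratum, parametrised by a vector space; hence it is smooth. No parity
argument is needed for the components: a parameter is joined to the centre by a quadratic curve,
which is Zariski connected. Finally `L` is its own orthogonal for the non-degenerate `ε`-component
of the form, whence the duality `(V ⊕ εV)/L ≅ L*`. -/

theorem linear_mem_polyFun (l : Module.Dual K E) : (fun x => l x) ∈ polyFun K E :=
  Algebra.subset_adjoin ⟨l, rfl⟩

theorem IsPolyMap.linear (f : E →ₗ[K] E') : IsPolyMap K f := fun l =>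
  linear_mem_polyFun (l ∘ₗ f)

theorem IsPolyMap.const (c : E') : IsPolyMap K (fun _ : E => c) := fun l =>
  (polyFun K E).algebraMap_mem (l c)

theorem IsPolyMap.add {f g : E → E'} (hf : IsPolyMap K f) (hg : IsPolyMap K g) :
    IsPolyMap K (fun x => f x + g x) := fun l => by
  simp only [map_add]
  exact (polyFun K E).add_mem (hf l) (hg l)

theorem IsPolyMap.linear_comp {f : E → E'} (hf : IsPolyMap K f) (g : E' →ₗ[K] E'') :
    IsPolyMap K (fun x => g (f x)) := fun l => hf (l ∘ₗ g)

theorem polyFun_comp_mem {f : E → E'} (hf : IsPolyMap K f) {F : E' → K} (hF : F ∈ polyFun K E') :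
    (fun x => F (f x)) ∈ polyFun K E := by
  refine Algebra.adjoin_induction (p := fun F _ => (fun x => F (f x)) ∈ polyFun K E)
    ?_ ?_ ?_ ?_ hF
  · rintro _ ⟨l, rfl⟩
    exact hf l
  · intro r
    exact (polyFun K E).algebraMap_mem r
  · intro F G _ _ h1 h2
    exact (polyFun K E).add_mem h1 h2
  · intro F G _ _ h1 h2
    exact (polyFun K E).mul_mem h1 h2

theorem IsPolyMap.comp {f : E → E'} {g : E' → E''} (hg : IsPolyMap K g) (hf : IsPolyMap K f) :
    IsPolyMap K (fun x => g (f x)) := fun l => polyFun_comp_mem hf (hg l)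

/-- Expanding the first argument in a finite basis turns the value into a sum of products of
polynomial functions. -/
theorem IsPolyMap.bilin {E₁ E₂ : Type*} [AddCommGroup E₁] [Module K E₁] [FiniteDimensional K E₁]
    [AddCommGroup E₂] [Module K E₂] (B : E₁ →ₗ[K] E₂ →ₗ[K] E') {f : E → E₁} {g : E → E₂}
    (hf : IsPolyMap K f) (hg : IsPolyMap K g) : IsPolyMap K (fun x => B (f x) (g x)) := fun l => by
  let e := Module.finBasis K E₁
  have h : (fun x => l (B (f x) (g x))) =
      ∑ j, (fun x => e.coord j (f x)) * (fun x => (l ∘ₗ B (e j)) (g x)) := by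
    funext x
    conv_lhs => rw [← e.sum_repr (f x)]
    simp only [map_sum, map_smul, LinearMap.sum_apply, LinearMap.smul_apply, smul_eq_mul,
      Finset.sum_apply, Pi.mul_apply, Module.Basis.coord_apply, LinearMap.comp_apply]
  rw [h]
  exact (polyFun K E).sum_mem fun j _ => (polyFun K E).mul_mem (hf _) (hg _)

theorem restrict_mem_coordRing (Z : Set E) {F : E → K} (hF : F ∈ polyFun K E) :
    (fun z : Z => F z) ∈ coordRing K Z := by
  refine Algebra.adjoin_induction (p := fun F _ => (fun z : Z => F z) ∈ coordRing K Z)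
    ?_ ?_ ?_ ?_ hF
  · rintro _ ⟨l, rfl⟩
    exact Algebra.subset_adjoin ⟨l, rfl⟩
  · intro r
    exact (coordRing K Z).algebraMap_mem r
  · intro F G _ _ h1 h2
    exact (coordRing K Z).add_mem h1 h2
  · intro F G _ _ h1 h2
    exact (coordRing K Z).mul_mem h1 h2

theorem exists_mvPolynomial_of_mem_polyFun {ι : Type*} [Finite ι] (e : Module.Basis ι K E)
    {F : E → K} (hF : F ∈ polyFun K E) :
    ∃ p : MvPolynomial ι K, ∀ x, F x = MvPolynomial.eval (e.repr x) p := by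
  have := Fintype.ofFinite ι
  refine Algebra.adjoin_induction
    (p := fun F _ => ∃ p : MvPolynomial ι K, ∀ x, F x = MvPolynomial.eval (e.repr x) p)
    ?_ ?_ ?_ ?_ hF
  · rintro _ ⟨l, rfl⟩
    refine ⟨∑ j, MvPolynomial.C (l (e j)) * MvPolynomial.X j, fun x => ?_⟩
    conv_lhs => rw [← e.sum_repr x]
    simp only [map_sum, map_smul, smul_eq_mul, map_mul, MvPolynomial.eval_C, MvPolynomial.eval_X,
      mul_comm]
  · intro r
    exact ⟨MvPolynomial.C r, fun x => by simp⟩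
  · rintro F G _ _ ⟨p, hp⟩ ⟨q, hq⟩
    exact ⟨p + q, fun x => by simp [hp, hq]⟩
  · rintro F G _ _ ⟨p, hp⟩ ⟨q, hq⟩
    exact ⟨p * q, fun x => by simp [hp, hq]⟩

end PolyMap

/-! ### Smoothness of parametrised affine varieties -/

section Smooth

variable {K : Type*} [Field K] [Infinite K] {E P : Type*} [AddCommGroup E] [Module K E]
  [AddCommGroup P] [Module K P] [FiniteDimensional K P]

/-- A variety isomorphic to an affine space is smooth. -/
theorem isSmoothPoint_of_parametrization {Z : Set E} {f : P → E} {g : E → P}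
    (hf : IsPolyMap K f) (hg : IsPolyMap K g) (hgf : ∀ u, g (f u) = u) (hZ : Z = Set.range f)
    (z : Z) : IsSmoothPoint K z := by
  let e := Module.finBasis K P
  have hZ' : ∀ z : Z, f (g z) = z := by
    rintro ⟨z, hz⟩
    obtain ⟨u, rfl⟩ : z ∈ Set.range f := hZ ▸ hz
    simp [hgf]
  let c : Fin (Module.finrank K P) → coordRing K Z := fun j =>
    ⟨fun z => e.coord j (g z), restrict_mem_coordRing Z (hg (e.coord j))⟩
  -- Pulling coordinates of the parameter space back along `g` identifies the coordinate ring of `Z`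
  -- with a polynomial ring. Injectivity uses that `K` is infinite, surjectivity that `f` is
  -- polynomial.
  let Φ : MvPolynomial (Fin (Module.finrank K P)) K →ₐ[K] coordRing K Z := MvPolynomial.aeval c
  have hΦ : ∀ p z, (Φ p : Z → K) z = MvPolynomial.eval (e.repr (g z)) p := by
    intro p z
    have : ((coordRing.eval K z).comp Φ) =
        MvPolynomial.aeval (fun j => e.repr (g z) j) := by
      ext j
      simp [Φ, c, coordRing.eval]
    have h2 := DFunLike.congr_fun this p
    rw [MvPolynomial.aeval_eq_eval] at h2
    exact h2
  have hinj : Function.Injective Φ := by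
    intro p q hpq
    refine MvPolynomial.funext fun x => ?_
    have hz : f (e.equivFun.symm x) ∈ Z := hZ ▸ ⟨_, rfl⟩
    have h1 := hΦ p ⟨_, hz⟩
    have h2 := hΦ q ⟨_, hz⟩
    have h3 : (e.repr (e.equivFun.symm x) : _ → K) = x := e.equivFun.apply_symm_apply x
    simp only [hgf, h3] at h1 h2
    rw [← h1, ← h2, hpq]
  have hsurj : Function.Surjective Φ := by
    rintro ⟨F, hF⟩
    suffices h : ∃ p, (Φ p : Z → K) = F by
      obtain ⟨p, hp⟩ := h
      exact ⟨p, Subtype.ext hp⟩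
    refine Algebra.adjoin_induction (p := fun F _ => ∃ p, (Φ p : Z → K) = F) ?_ ?_ ?_ ?_ hF
    · rintro _ ⟨l, rfl⟩
      obtain ⟨p, hp⟩ := exists_mvPolynomial_of_mem_polyFun e (hf l)
      refine ⟨p, funext fun z => ?_⟩
      rw [hΦ, ← hp, hZ']
    · intro r
      exact ⟨algebraMap _ _ r, by simp⟩
    · rintro F G _ _ ⟨p, hp⟩ ⟨q, hq⟩
      exact ⟨p + q, by simp [hp, hq]⟩
    · rintro F G _ _ ⟨p, hp⟩ ⟨q, hq⟩
      exact ⟨p * q, by simp [hp, hq]⟩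
  have : Algebra.FormallySmooth K (coordRing K Z) :=
    Algebra.FormallySmooth.of_equiv (AlgEquiv.ofBijective Φ ⟨hinj, hsurj⟩)
  exact inferInstanceAs (Algebra.IsSmoothAt K (pointIdeal K z))

/-- The left inverse `g` need not land in `S` off the image, so it is corrected by a projection onto
`S`. -/
theorem isSmoothPoint_of_parametrization_submodule {Z : Set E} (S : Submodule K P) {f : P → E}
    {g : E → P} (hf : IsPolyMap K f) (hg : IsPolyMap K g) (hgf : ∀ u ∈ S, g (f u) = u)
    (hZ : Z = f '' S) (z : Z) : IsSmoothPoint K z := by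
  obtain ⟨N, hN⟩ := S.exists_isCompl
  refine isSmoothPoint_of_parametrization (hf.comp (IsPolyMap.linear S.subtype))
    (hg.linear_comp (S.projectionOnto N hN)) (fun u => ?_) ?_ z
  · rw [Submodule.subtype_apply, hgf u u.2, Submodule.projectionOnto_apply_left]
  · rw [hZ]
    ext x
    simp

end Smooth

/-! ### Zariski tangent vectors -/

section Tangent

variable {K : Type*} [Field K] {E : Type*} [AddCommGroup E] [Module K E]

/-- A tangent vector defines a point of the variety with values in the dual numbers. -/
theorem exists_algHom_of_mem_affineTangentSpace {Z : Set E} {z : Z} {v : E}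
    (hv : v ∈ affineTangentSpace K z) :
    ∃ θ : coordRing K Z →ₐ[K] DualNumber K, ∀ l : Module.Dual K E,
      θ (coordRing.linear K Z l) = TrivSqZeroExt.inl (l z) + TrivSqZeroExt.inr (l v) := by
  obtain ⟨D, hD, hDl⟩ := hv
  have h1 : D 1 = 0 := by
    have := hD 1 1
    simpa using this
  refine ⟨AlgHom.ofLinearMap
    ((TrivSqZeroExt.inlAlgHom K K K).toLinearMap ∘ₗ (coordRing.eval K z).toLinearMap +
      TrivSqZeroExt.inrHom K K ∘ₗ D) ?_ ?_, fun l => ?_⟩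
  · ext <;> simp [h1]
  · intro f g
    ext
    · simp
    · simp [hD]; ring
  · simp [hDl]; rfl

variable {Z : Set E} {h0 : (0 : E) ∈ Z} {v : E}

/-- Differentiating a quadratic equation at the origin. -/
theorem linear_eq_zero_of_mem_affineTangentSpace [FiniteDimensional K E]
    (hv : v ∈ affineTangentSpace K (⟨0, h0⟩ : Z)) (l : Module.Dual K E)
    (B : E →ₗ[K] Module.Dual K E) (h : ∀ z ∈ Z, l z + B z z = 0) : l v = 0 := by
  obtain ⟨θ, hθ⟩ := exists_algHom_of_mem_affineTangentSpace hv
  let e := Module.finBasis K E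
  have h1 : coordRing.linear K Z l +
      ∑ j, coordRing.linear K Z (e.coord j) * coordRing.linear K Z (B (e j)) = 0 := by
    ext z
    have h2 : B z z = ∑ j, e.repr z j * B (e j) z := by
      conv_lhs => enter [1]; rw [← e.sum_repr (z : E)]
      simp only [map_sum, map_smul, LinearMap.sum_apply, LinearMap.smul_apply, smul_eq_mul]
    have := h z z.2
    rw [h2] at this
    simpa [coordRing.linear, Finset.sum_apply] using this
  -- At the origin `θ` sends every linear functional into `εK`, so the quadratic terms die and the
  -- `ε`-component of the equation is `l v`.
  have h2 := congrArg (fun a => (θ a).snd) h1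
  simpa [hθ] using h2

theorem map_inr_mul_map_inr {m n o : Type*} [Fintype n] (A : Matrix m n K) (B : Matrix n o K) :
    (A.map (TrivSqZeroExt.inr : K → DualNumber K)) *
      (B.map (TrivSqZeroExt.inr : K → DualNumber K)) = 0 := by
  ext <;> simp [Matrix.mul_apply]

/-- The block `1 + εX` is invertible with inverse `1 - εX`. In its Schur complement the correction
is a product of terms in `ε` and vanishes, so the determinant is a unit times `εd`. -/
theorem eq_zero_of_det_fromBlocks_inr {n : Type*} [Fintype n] [DecidableEq n]
    (X : Matrix n n K) (Y : Matrix n Unit K) (Y' : Matrix Unit n K) (d : Matrix Unit Unit K)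
    (h : (Matrix.fromBlocks (1 + X.map (TrivSqZeroExt.inr : K → DualNumber K))
      (Y.map TrivSqZeroExt.inr) (Y'.map TrivSqZeroExt.inr) (d.map TrivSqZeroExt.inr)).det = 0) :
    d () () = 0 := by
  let A := 1 + X.map (TrivSqZeroExt.inr : K → DualNumber K)
  let A' := 1 - X.map (TrivSqZeroExt.inr : K → DualNumber K)
  have hA : A' * A = 1 := by
    simp [A, A', sub_mul, mul_add, map_inr_mul_map_inr]
  have hA' : A * A' = 1 := by
    simp [A, A', add_mul, mul_sub, map_inr_mul_map_inr]
  let _ : Invertible A := ⟨A', hA, hA'⟩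
  have h1 : Y'.map (TrivSqZeroExt.inr : K → DualNumber K) * ⅟A *
      Y.map (TrivSqZeroExt.inr : K → DualNumber K) = 0 := by
    change Y'.map (TrivSqZeroExt.inr : K → DualNumber K) * A' *
      Y.map (TrivSqZeroExt.inr : K → DualNumber K) = 0
    rw [Matrix.mul_sub, Matrix.mul_one, map_inr_mul_map_inr, sub_zero, map_inr_mul_map_inr]
  have h2 := Matrix.det_fromBlocks₁₁ A (Y.map (TrivSqZeroExt.inr : K → DualNumber K))
    (Y'.map TrivSqZeroExt.inr) (d.map TrivSqZeroExt.inr)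
  rw [h1, h, sub_zero] at h2
  have hu : IsUnit A.det := (Matrix.isUnit_iff_isUnit_det A).1 (isUnit_of_invertible A)
  have h3 := (hu.mul_right_eq_zero).1 h2.symm
  simpa using congrArg TrivSqZeroExt.snd h3

/-- Differentiating the condition that the rank of a matrix does not increase. -/
theorem map_mem_range_of_mem_affineTangentSpace
    (hv : v ∈ affineTangentSpace K (⟨0, h0⟩ : Z)) {X Y : Type*} [AddCommGroup X] [Module K X]
    [AddCommGroup Y] [Module K Y] [FiniteDimensional K Y]
    (α₀ : X →ₗ[K] Y) (α : E →ₗ[K] X →ₗ[K] Y)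
    (h : ∀ z ∈ Z, Module.finrank K (LinearMap.range (α₀ + α z)) ≤
      Module.finrank K (LinearMap.range α₀)) (x : X) (hx : α₀ x = 0) :
    α v x ∈ LinearMap.range α₀ := by
  obtain ⟨θ, hθ⟩ := exists_algHom_of_mem_affineTangentSpace hv
  by_contra hy
  -- If the conclusion fails, `μ` detects it. Bordering a maximal invertible minor of `α₀` by the
  -- vector `x` and the functional `μ` gives a minor of size one more than the rank, which must
  -- vanish on `Z`.
  obtain ⟨μ, hμ0, hμ⟩ := Submodule.exists_le_ker_of_notMem hy
  let e := Module.finBasis K (LinearMap.range α₀)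
  obtain ⟨π, hπ⟩ := (LinearMap.range α₀).subtype.exists_leftInverse_of_injective
    (LinearMap.range α₀).ker_subtype
  choose xs hxs using fun j => (e j).2
  let n := Fin (Module.finrank K (LinearMap.range α₀))
  let xx : n ⊕ Unit → X := Sum.elim xs fun _ => x
  let lam : n ⊕ Unit → Module.Dual K Y := Sum.elim (fun j => e.coord j ∘ₗ π) fun _ => μ
  let ent : n ⊕ Unit → n ⊕ Unit → Module.Dual K E := fun j k =>
    lam j ∘ₗ (LinearMap.applyₗ (xx k)) ∘ₗ α
  let M : Matrix (n ⊕ Unit) (n ⊕ Unit) (coordRing K Z) := Matrix.of fun j k =>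
    algebraMap K _ (lam j (α₀ (xx k))) + coordRing.linear K Z (ent j k)
  have hdet : M.det = 0 := by
    apply Subtype.ext
    funext z
    change coordRing.eval K z M.det = 0
    rw [AlgHom.map_det]
    by_contra hne
    have hind := Matrix.linearIndependent_cols_of_det_ne_zero hne
    let β := α₀ + α z
    have h1 : (fun k => β (xx k)) = (LinearMap.range β).subtype ∘
        fun k => ⟨β (xx k), LinearMap.mem_range_self _ _⟩ := rfl
    have h2 : ((coordRing.eval K z).mapMatrix M).col =
        (LinearMap.pi lam) ∘ fun k => β (xx k) := by
      funext k j
      simp [M, Matrix.col, coordRing.eval, coordRing.linear, ent, β]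
    rw [h2] at hind
    have h3 := hind.of_comp
    rw [h1] at h3
    have h4 := h3.of_comp.fintype_card_le_finrank
    have h5 := h z z.2
    simp [n, β] at h4 h5
    omega
  have hπe : ∀ j, π (e j) = e j := fun j => DFunLike.congr_fun hπ (e j)
  have hdet' : (θ.mapMatrix M).det = 0 := by rw [← AlgHom.map_det, hdet, map_zero]
  -- The constant part is the identity in the corner of the rank and zero elsewhere, because `α₀ x =
  -- 0` and `μ` kills the range of `α₀`. The remaining corner is `ε μ(α v x)`.
  have hblocks : θ.mapMatrix M = Matrix.fromBlocks
      (1 + (Matrix.of fun j k => ent (.inl j) (.inl k) v).map TrivSqZeroExt.inr)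
      ((Matrix.of fun j k => ent (.inl j) (.inr k) v).map TrivSqZeroExt.inr)
      ((Matrix.of fun j k => ent (.inr j) (.inl k) v).map TrivSqZeroExt.inr)
      ((Matrix.of fun j k => ent (.inr j) (.inr k) v).map TrivSqZeroExt.inr) := by
    have hμ' : ∀ j, μ (e j) = 0 := fun j => hμ (e j).2
    ext j k <;> rcases j with j | j <;> rcases k with k | k <;>
      simp [M, hθ, lam, xx, hxs, hπe, hx, hμ', Matrix.one_apply, Finsupp.single_apply,
        eq_comm]
  rw [hblocks] at hdet'
  have := eq_zero_of_det_fromBlocks_inr _ _ _ _ hdet'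
  exact hμ0 (by simpa [ent, lam, xx] using this)

end Tangent

/-! ### Curves -/

section Curve

variable {K : Type*} [Field K] {E : Type*} [AddCommGroup E] [Module K E]

theorem exists_polynomial_of_linear (z a c : E) (l : Module.Dual K E) :
    ∀ t : K, l (z + t • a + t ^ 2 • c) =
      (Polynomial.C (l z) + Polynomial.X * Polynomial.C (l a) +
        Polynomial.X ^ 2 * Polynomial.C (l c)).eval t := by
  intro t
  simp only [map_add, map_smul, smul_eq_mul, Polynomial.eval_add, Polynomial.eval_C,
    Polynomial.eval_mul, Polynomial.eval_X, Polynomial.eval_pow]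

/-- On the curve a polynomial function becomes a polynomial in `t`; if it is non-zero at `t₀` it has
finitely many roots. The property survives finite intersections and unions. -/
theorem finite_compl_preimage_of_isOpen_zariski (z a c : E) {U : Set E}
    (hU : @IsOpen _ (zariski K E) U) {t₀ : K} (ht₀ : z + t₀ • a + t₀ ^ 2 • c ∈ U) :
    {t : K | z + t • a + t ^ 2 • c ∉ U}.Finite := by
  induction hU generalizing t₀ with
  | basic U hU =>
    obtain ⟨f, hf, rfl⟩ := hU
    have hex : ∃ p : Polynomial K, ∀ t, f (z + t • a + t ^ 2 • c) = p.eval t := by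
      refine Algebra.adjoin_induction
        (p := fun f _ => ∃ p : Polynomial K, ∀ t, f (z + t • a + t ^ 2 • c) = p.eval t)
        ?_ ?_ ?_ ?_ hf
      · rintro _ ⟨l, rfl⟩
        exact ⟨_, exists_polynomial_of_linear z a c l⟩
      · intro r
        exact ⟨Polynomial.C r, fun x => by simp⟩
      · rintro F G _ _ ⟨p, hp⟩ ⟨q, hq⟩
        exact ⟨p + q, fun x => by simp [hp, hq]⟩
      · rintro F G _ _ ⟨p, hp⟩ ⟨q, hq⟩
        exact ⟨p * q, fun x => by simp [hp, hq]⟩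
    obtain ⟨p, hp⟩ := hex
    have hp0 : p ≠ 0 := by
      rintro rfl
      exact ht₀ (by rw [hp]; simp)
    simpa [hp] using Polynomial.finite_setOfPred_isRoot hp0
  | univ => simp
  | inter U V _ _ h1 h2 =>
    refine ((h1 ht₀.1).union (h2 ht₀.2)).subset fun t ht => ?_
    by_contra hcon
    simp only [Set.mem_union, Set.mem_ofPred_eq, not_or, not_not] at hcon
    exact ht ⟨hcon.1, hcon.2⟩
  | sUnion S _ hS =>
    obtain ⟨U, hU, hU'⟩ := ht₀
    refine (hS U hU hU').subset fun t ht h => ht ⟨U, hU, h⟩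

variable [Infinite K]

/-- The velocity of a quadratic curve inside a variety is a tangent vector. -/
theorem mem_affineTangentSpace_of_curve {Z : Set E} (z : Z) (a c : E)
    (h : ∀ t : K, (z : E) + t • a + t ^ 2 • c ∈ Z) : a ∈ affineTangentSpace K z := by
  have hex : ∀ f : coordRing K Z, ∃ p : Polynomial K, ∀ t,
      (f : Z → K) ⟨_, h t⟩ = p.eval t := by
    rintro ⟨f, hf⟩
    refine Algebra.adjoin_induction
      (p := fun f _ => ∃ p : Polynomial K, ∀ t, f ⟨_, h t⟩ = p.eval t) ?_ ?_ ?_ ?_ hf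
    · rintro _ ⟨l, rfl⟩
      exact ⟨_, exists_polynomial_of_linear _ a c l⟩
    · intro r
      exact ⟨Polynomial.C r, fun x => by simp⟩
    · rintro F G _ _ ⟨p, hp⟩ ⟨q, hq⟩
      exact ⟨p + q, fun x => by simp [hp, hq]⟩
    · rintro F G _ _ ⟨p, hp⟩ ⟨q, hq⟩
      exact ⟨p * q, fun x => by simp [hp, hq]⟩
  choose P hP using hex
  have h0 : ∀ f, (P f).eval 0 = coordRing.eval K z f := by
    intro f
    rw [← hP]
    change (f : Z → K) _ = (f : Z → K) z
    exact congrArg (f : Z → K) (Subtype.ext (by simp))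
  -- The derivation restricts a function to the curve and differentiates at `t = 0`. Over an
  -- infinite field the restricted polynomial is determined by its values, which makes the choice
  -- `P` additive and multiplicative.
  refine ⟨{ toFun := fun f => (P f).derivative.eval 0, map_add' := ?_, map_smul' := ?_ }, ?_, ?_⟩
  · intro f g
    have : P (f + g) = P f + P g := Polynomial.funext fun t => by simp [← hP]
    simp [this]
  · intro r f
    have : P (r • f) = r • P f := Polynomial.funext fun t => by simp [← hP]
    simp [this]
  · intro f g
    have : P (f * g) = P f * P g := Polynomial.funext fun t => by simp [← hP]
    simp [this, h0]
    ring
  · intro l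
    have : P (coordRing.linear K Z l) = Polynomial.C (l z) + Polynomial.X * Polynomial.C (l a) +
        Polynomial.X ^ 2 * Polynomial.C (l c) := Polynomial.funext fun t => by
      rw [← hP, ← exists_polynomial_of_linear]
      rfl
    simp [this]

/-- A quadratic curve in a chart of the Grassmannian is connected. -/
theorem isPreconnected_range_grChart_curve {W : Type*} [AddCommGroup W] [Module K W]
    {L C : Submodule K W} (hLC : IsCompl L C) (z a c : L →ₗ[K] C) :
    @IsPreconnected _ (grTopology K W)
      (Set.range fun t : K => grChart L C (z + t • a + t ^ 2 • c)) := by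
  let _ := grTopology K W
  have hopen : ∀ U : Set (Submodule K W), IsOpen U →
      @IsOpen _ (zariski K (L →ₗ[K] C)) (grChart L C ⁻¹' U) := by
    intro U hU
    have h1 := isOpen_iSup_iff.1 (isOpen_iSup_iff.1 (isOpen_iSup_iff.1 hU L) C) hLC
    exact isOpen_coinduced.1 h1
  rintro U V hU hV - ⟨_, ⟨t₁, rfl⟩, h1⟩ ⟨_, ⟨t₂, rfl⟩, h2⟩
  have f1 := finite_compl_preimage_of_isOpen_zariski z a c (t₀ := t₁) (hopen U hU) h1
  have f2 := finite_compl_preimage_of_isOpen_zariski z a c (t₀ := t₂) (hopen V hV) h2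
  -- Each open set meeting the curve misses only finitely many parameters, so over an infinite field
  -- two such sets share a point of the curve.
  obtain ⟨t, ht⟩ := (f1.union f2).exists_notMem
  simp only [Set.mem_union, Set.mem_ofPred_eq, not_or, not_not] at ht
  exact ⟨_, ⟨t, rfl⟩, ht.1, ht.2⟩

end Curve

/-! ### Coordinates on `V ⊕ εV` -/

section Pair

variable {K : Type*} [Field K] {V : Type*} [AddCommGroup V] [Module K V]

variable (K V) in
/-- The projection `V ⊕ εV → V`, `a + ε b ↦ b`. -/
def imV : DualExt K V →ₗ[K] V :=
  (TensorProduct.lid K V).toLinearMap ∘ₗ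
    LinearMap.rTensor V (TrivSqZeroExt.sndHom K K)

theorem pairMap_apply (a b : V) : pairMap K V (a, b) =
    (TensorProduct.tmul K (1 : DualNumber K) a + TensorProduct.tmul K DualNumber.eps b :
      DualNumber K ⊗[K] V) := by
  rfl

@[simp] theorem projV_pairMap (x : V × V) : projV K V (pairMap K V x) = x.1 := by
  obtain ⟨a, b⟩ := x
  rw [pairMap_apply]
  refine (map_add (projV K V) _ _).trans ?_
  change (1 : DualNumber K).fst • a + (DualNumber.eps : DualNumber K).fst • b = a
  simp

@[simp] theorem imV_pairMap (x : V × V) : imV K V (pairMap K V x) = x.2 := by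
  obtain ⟨a, b⟩ := x
  rw [pairMap_apply]
  refine (map_add (imV K V) _ _).trans ?_
  change (1 : DualNumber K).snd • a + (DualNumber.eps : DualNumber K).snd • b = b
  simp

theorem pairMap_projV_imV (w : DualExt K V) : pairMap K V (projV K V w, imV K V w) = w := by
  have h : pairMap K V ∘ₗ LinearMap.prod (projV K V) (imV K V) = LinearMap.id := by
    refine TensorProduct.ext' fun z v => ?_
    change pairMap K V (z.fst • v, z.snd • v) = _
    rw [pairMap_apply]
    rw [← TensorProduct.smul_tmul, ← TensorProduct.smul_tmul, ← TensorProduct.add_tmul]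
    change _ = z ⊗ₜ[K] v
    congr 1
    ext <;> simp
  exact DFunLike.congr_fun h w

theorem pairMap_injective : Function.Injective (pairMap K V) := fun x y h =>
  Prod.ext (by simpa using congrArg (projV K V) h) (by simpa using congrArg (imV K V) h)

theorem exists_pairMap (w : DualExt K V) : ∃ a b, w = pairMap K V (a, b) :=
  ⟨_, _, (pairMap_projV_imV w).symm⟩

@[simp] theorem eps_smul_pairMap (x : V × V) :
    (DualNumber.eps : DualNumber K) • pairMap K V x = pairMap K V (0, x.1) := by
  obtain ⟨a, b⟩ := x
  rw [pairMap_apply, pairMap_apply]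
  erw [smul_add, TensorProduct.smul_tmul', TensorProduct.smul_tmul']
  simp only [smul_eq_mul, mul_one, DualNumber.eps_mul_eps, TensorProduct.zero_tmul,
    TensorProduct.tmul_zero, zero_add]
  exact add_zero _

theorem eps_smul_eq (w : DualExt K V) :
    (DualNumber.eps : DualNumber K) • w = pairMap K V (0, projV K V w) := by
  obtain ⟨a, b, rfl⟩ := exists_pairMap w
  simp

theorem extForm_pairMap (b : LinearMap.BilinForm K V) (x y : V × V) :
    extForm b (pairMap K V x) (pairMap K V y) =
      TrivSqZeroExt.inl (b x.1 y.1) + TrivSqZeroExt.inr (b x.1 y.2 + b x.2 y.1) := by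
  obtain ⟨a, a'⟩ := x
  obtain ⟨c, c'⟩ := y
  rw [pairMap_apply, pairMap_apply]
  have h : ∀ (z z' : DualNumber K) (v v' : V),
      extForm b (z ⊗ₜ[K] v : DualNumber K ⊗[K] V) (z' ⊗ₜ[K] v' : DualNumber K ⊗[K] V) =
        b v v' • (z * z') := fun z z' v v' =>
    (LinearMap.BilinForm.baseChange_tmul (A := DualNumber K) (B₂ := b) z v z' v').trans
      (by rw [mul_comm])
  erw [map_add, map_add, LinearMap.add_apply, LinearMap.add_apply, h, h, h, h]
  ext <;> simp [add_comm]

variable (K V) in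
/-- `V × V ≅ V ⊕ εV`. -/
def pairEquiv : (V × V) ≃ₗ[K] DualExt K V :=
  LinearEquiv.ofBijective (pairMap K V) ⟨pairMap_injective, fun w => ⟨_, pairMap_projV_imV w⟩⟩

instance [FiniteDimensional K V] : FiniteDimensional K (DualExt K V) :=
  (pairEquiv K V).finiteDimensional

theorem finrank_dualExt [FiniteDimensional K V] :
    Module.finrank K (DualExt K V) = Module.finrank K V + Module.finrank K V := by
  rw [← (pairEquiv K V).finrank_eq, Module.finrank_prod]

/-- The subspace `{b | ε b ∈ L}` of `V`. -/
def epsPart (L : Submodule K (DualExt K V)) : Submodule K V :=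
  L.comap (pairMap K V ∘ₗ LinearMap.inr K V V)

@[simp] theorem mem_epsPart {L : Submodule K (DualExt K V)} {b : V} :
    b ∈ epsPart L ↔ pairMap K V (0, b) ∈ L := Iff.rfl

theorem IsEpsStable.map_le {L : Submodule K (DualExt K V)} (h : IsEpsStable L) :
    L.map (projV K V) ≤ epsPart L := by
  rintro _ ⟨w, hw, rfl⟩
  rw [mem_epsPart, ← eps_smul_eq]
  exact h w hw

/-- This is rank-nullity for `π` on `L`, whose kernel `L ∩ εV` is a copy of `epsPart L`. -/
theorem finrank_eq_stratumIndex_add [FiniteDimensional K V] (L : Submodule K (DualExt K V)) :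
    Module.finrank K L = stratumIndex L + Module.finrank K (epsPart L) := by
  rw [← ((projV K V).domRestrict L).finrank_range_add_finrank_ker, stratumIndex,
    LinearMap.range_domRestrict]
  congr 1
  let f : epsPart L →ₗ[K] L := ((pairMap K V ∘ₗ LinearMap.inr K V V).domRestrict (epsPart L)).codRestrict
    L fun x => x.2
  have hf : Function.Injective f := fun x y h => Subtype.ext
    (congrArg Prod.snd (pairMap_injective (congrArg Subtype.val h)))
  rw [← LinearMap.finrank_range_of_inj hf]
  suffices h : LinearMap.ker ((projV K V).domRestrict L) = LinearMap.range f by rw [h]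
  ext ⟨w, hw⟩
  constructor
  · intro h
    have h0 : projV K V w = 0 := h
    have hw' : w = pairMap K V (0, imV K V w) := by
      conv_lhs => rw [← pairMap_projV_imV w, h0]
    exact ⟨⟨imV K V w, by rw [mem_epsPart, ← hw']; exact hw⟩, Subtype.ext hw'.symm⟩
  · rintro ⟨y, hy⟩
    have := congrArg Subtype.val hy
    change pairMap K V (0, y) = w at this
    change projV K V w = 0
    rw [← this, projV_pairMap]

end Pair

/-! ### The subspaces attached to flags -/

section Flag

variable {K : Type*} [Field K] {V : Type*} [AddCommGroup V] [Module K V]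

theorem FlagHom.pairMap_mem_toSubmodule (x : FlagHom K V) (a b : V) :
    pairMap K V (a, b) ∈ x.toSubmodule ↔ ∃ ha : a ∈ x.F, x.hom ⟨a, ha⟩ = x.G.mkQ b := by
  constructor
  · rintro ⟨_, ⟨⟨c, d⟩, h, rfl⟩, h'⟩
    have h'' := pairMap_injective h'
    simp only [LinearMap.prodMap_apply, Prod.mk.injEq] at h''
    obtain ⟨rfl, rfl⟩ := h''
    exact ⟨c.2, h⟩
  · rintro ⟨ha, h⟩
    exact ⟨(a, b), ⟨(⟨a, ha⟩, b), h, rfl⟩, rfl⟩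

theorem FlagHom.map_projV_toSubmodule (x : FlagHom K V) :
    x.toSubmodule.map (projV K V) = x.F := by
  ext a
  constructor
  · rintro ⟨w, hw, rfl⟩
    rw [← pairMap_projV_imV w] at hw
    exact ((x.pairMap_mem_toSubmodule _ _).1 hw).1
  · intro ha
    obtain ⟨b, hb⟩ := x.G.mkQ_surjective (x.hom ⟨a, ha⟩)
    exact ⟨pairMap K V (a, b), (x.pairMap_mem_toSubmodule _ _).2 ⟨ha, hb.symm⟩, by simp⟩

theorem FlagHom.epsPart_toSubmodule (x : FlagHom K V) : epsPart x.toSubmodule = x.G := by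
  ext b
  rw [mem_epsPart, x.pairMap_mem_toSubmodule]
  constructor
  · rintro ⟨h0, h⟩
    have : (⟨0, h0⟩ : x.F) = 0 := rfl
    rw [this, map_zero, eq_comm, Submodule.mkQ_apply, Submodule.Quotient.mk_eq_zero] at h
    exact h
  · intro hb
    refine ⟨x.F.zero_mem, ?_⟩
    have : (⟨0, x.F.zero_mem⟩ : x.F) = 0 := rfl
    rw [this, map_zero, eq_comm, Submodule.mkQ_apply, Submodule.Quotient.mk_eq_zero]
    exact hb

theorem FlagHom.isEpsStable_toSubmodule (x : FlagHom K V) : IsEpsStable x.toSubmodule := by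
  intro w hw
  rw [eps_smul_eq, ← mem_epsPart, x.epsPart_toSubmodule]
  apply x.le
  rw [← x.map_projV_toSubmodule]
  exact ⟨w, hw, rfl⟩

theorem FlagHom.toSubmodule_injective :
    Function.Injective (FlagHom.toSubmodule : FlagHom K V → _) := by
  intro x y h
  have hF : x.F = y.F := by rw [← x.map_projV_toSubmodule, h, y.map_projV_toSubmodule]
  have hG : x.G = y.G := by rw [← x.epsPart_toSubmodule, h, y.epsPart_toSubmodule]
  have hhom : ∀ a (ha : a ∈ x.F) (ha' : a ∈ y.F) b, x.hom ⟨a, ha⟩ = x.G.mkQ b →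
      y.hom ⟨a, ha'⟩ = y.G.mkQ b := by
    intro a ha ha' b hb
    have := (x.pairMap_mem_toSubmodule a b).2 ⟨ha, hb⟩
    rw [h, y.pairMap_mem_toSubmodule] at this
    exact this.2
  obtain ⟨F, G, hle, u⟩ := x
  obtain ⟨F', G', hle', u'⟩ := y
  dsimp only at hF hG hhom
  subst hF hG
  congr 1
  ext ⟨a, ha⟩
  obtain ⟨b, hb⟩ := G.mkQ_surjective (u ⟨a, ha⟩)
  rw [hhom a ha ha b hb.symm, hb]

/-- Lift `π(L)` to `L` by a section and take the `ε`-coordinate: different lifts differ by `epsPart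
L`, so the class modulo `epsPart L` is canonical. -/
theorem IsEpsStable.exists_flagHom {L : Submodule K (DualExt K V)} (hL : IsEpsStable L) :
    ∃ x : FlagHom K V, x.toSubmodule = L := by
  let π : L →ₗ[K] L.map (projV K V) := (projV K V).submoduleMap L
  obtain ⟨σ, hσ⟩ := π.exists_rightInverse_of_surjective
    (LinearMap.range_eq_top.2 ((projV K V).submoduleMap_surjective L))
  have hσ' : ∀ a, projV K V (σ a) = a := fun a =>
    congrArg Subtype.val (DFunLike.congr_fun hσ a)
  let x : FlagHom K V :=
    { F := L.map (projV K V)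
      G := epsPart L
      le := hL.map_le
      hom := (epsPart L).mkQ ∘ₗ imV K V ∘ₗ L.subtype ∘ₗ σ }
  refine ⟨x, ?_⟩
  have key : ∀ a (ha : a ∈ x.F) b, x.hom ⟨a, ha⟩ = x.G.mkQ b ↔ pairMap K V (a, b) ∈ L := by
    intro a ha b
    have h1 : pairMap K V (a, imV K V (σ ⟨a, ha⟩)) ∈ L := by
      have := (σ ⟨a, ha⟩).2
      rwa [← pairMap_projV_imV (σ ⟨a, ha⟩ : DualExt K V), hσ'] at this
    have h2 : pairMap K V (a, imV K V (σ ⟨a, ha⟩)) =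
        pairMap K V (a, b) + pairMap K V (0, imV K V (σ ⟨a, ha⟩) - b) := by
      rw [← map_add]; simp
    change (epsPart L).mkQ (imV K V (σ ⟨a, ha⟩)) = (epsPart L).mkQ b ↔ _
    rw [Submodule.mkQ_apply, Submodule.mkQ_apply,
      Submodule.Quotient.eq, mem_epsPart]
    constructor
    · intro h
      rw [h2] at h1
      exact (Submodule.add_mem_iff_left _ h).1 h1
    · intro h
      rw [h2] at h1
      exact (Submodule.add_mem_iff_right _ h).1 h1
  ext w
  obtain ⟨a, b, rfl⟩ := exists_pairMap w
  rw [x.pairMap_mem_toSubmodule]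
  constructor
  · rintro ⟨ha, h⟩
    exact (key a ha b).1 h
  · intro h
    have ha : a ∈ x.F := ⟨_, h, by simp⟩
    exact ⟨ha, (key a ha b).2 h⟩

theorem image_flagBundle [FiniteDimensional K V] (n i : ℕ) :
    FlagHom.toSubmodule '' flagBundle K V n i = sigmaStratum K V n i := by
  have h : ∀ x : FlagHom K V, x ∈ flagBundle K V n i ↔ x.toSubmodule ∈ sigmaStratum K V n i := by
    intro x
    have h1 := finrank_eq_stratumIndex_add x.toSubmodule
    have h2 : stratumIndex x.toSubmodule = Module.finrank K x.F := by
      rw [stratumIndex, x.map_projV_toSubmodule]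
    rw [x.epsPart_toSubmodule] at h1
    simp only [flagBundle, sigmaStratum, Set.mem_ofPred_eq, x.isEpsStable_toSubmodule, true_and]
    omega
  ext L
  constructor
  · rintro ⟨x, hx, rfl⟩
    exact (h x).1 hx
  · intro hL
    obtain ⟨x, rfl⟩ := hL.2.1.exists_flagHom
    exact ⟨x, (h x).2 hL, rfl⟩

end Flag

/-! ### Charts attached to a decomposition of `V` -/

/-- A decomposition `V = F ⊕ A ⊕ B`. -/
structure Splitting (K V : Type*) [Field K] [AddCommGroup V] [Module K V] where
  F : Submodule K V
  A : Submodule K V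
  B : Submodule K V
  isCompl : IsCompl F (A ⊔ B)
  disjoint : Disjoint A B

namespace Splitting

variable {K : Type*} [Field K] {V : Type*} [AddCommGroup V] [Module K V] (D : Splitting K V)

theorem isCompl_A : IsCompl D.A (D.F ⊔ D.B) := by
  refine ⟨?_, ?_⟩
  · rw [sup_comm]
    exact D.disjoint.disjoint_sup_right_of_disjoint_sup_left D.isCompl.disjoint.symm
  · rw [codisjoint_iff, sup_left_comm]
    exact D.isCompl.sup_eq_top

theorem isCompl_B : IsCompl D.B (D.F ⊔ D.A) := by
  refine ⟨?_, ?_⟩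
  · rw [sup_comm]
    refine D.disjoint.symm.disjoint_sup_right_of_disjoint_sup_left ?_
    rw [sup_comm]
    exact D.isCompl.disjoint.symm
  · rw [codisjoint_iff, sup_left_comm, sup_comm D.B]
    exact D.isCompl.sup_eq_top

/-- The projection to `F`. -/
def pF : V →ₗ[K] D.F := D.F.projectionOnto (D.A ⊔ D.B) D.isCompl

/-- The projection to `A`. -/
def pA : V →ₗ[K] D.A := D.A.projectionOnto (D.F ⊔ D.B) D.isCompl_A

/-- The projection to `B`. -/
def pB : V →ₗ[K] D.B := D.B.projectionOnto (D.F ⊔ D.A) D.isCompl_B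

@[simp] theorem pF_F (x : D.F) : D.pF x = x := Submodule.projectionOnto_apply_left _ x
@[simp] theorem pA_A (x : D.A) : D.pA x = x := Submodule.projectionOnto_apply_left _ x
@[simp] theorem pB_B (x : D.B) : D.pB x = x := Submodule.projectionOnto_apply_left _ x
@[simp] theorem pF_A (x : D.A) : D.pF x = 0 :=
  Submodule.projectionOnto_apply_of_mem_right _ (Submodule.mem_sup_left x.2)
@[simp] theorem pF_B (x : D.B) : D.pF x = 0 :=
  Submodule.projectionOnto_apply_of_mem_right _ (Submodule.mem_sup_right x.2)
@[simp] theorem pA_F (x : D.F) : D.pA x = 0 :=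
  Submodule.projectionOnto_apply_of_mem_right _ (Submodule.mem_sup_left x.2)
@[simp] theorem pA_B (x : D.B) : D.pA x = 0 :=
  Submodule.projectionOnto_apply_of_mem_right _ (Submodule.mem_sup_right x.2)
@[simp] theorem pB_F (x : D.F) : D.pB x = 0 :=
  Submodule.projectionOnto_apply_of_mem_right _ (Submodule.mem_sup_left x.2)
@[simp] theorem pB_A (x : D.A) : D.pB x = 0 :=
  Submodule.projectionOnto_apply_of_mem_right _ (Submodule.mem_sup_right x.2)

theorem exists_add (v : V) : ∃ (f : D.F) (a : D.A) (b : D.B), v = f + a + b := by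
  have hv : v ∈ D.F ⊔ (D.A ⊔ D.B) := D.isCompl.sup_eq_top ▸ Submodule.mem_top
  obtain ⟨f, hf, w, hw, rfl⟩ := Submodule.mem_sup.1 hv
  obtain ⟨a, ha, b, hb, rfl⟩ := Submodule.mem_sup.1 hw
  exact ⟨⟨f, hf⟩, ⟨a, ha⟩, ⟨b, hb⟩, by simp [add_assoc]⟩

theorem add_projections (v : V) : (D.pF v : V) + D.pA v + D.pB v = v := by
  obtain ⟨f, a, b, rfl⟩ := D.exists_add v
  simp

theorem mem_F_sup_A {v : V} : v ∈ D.F ⊔ D.A ↔ D.pB v = 0 :=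
  (Submodule.projectionOnto_apply_eq_zero_iff D.isCompl_B).symm

/-- The parametrisation of the subspace `{f + ε (ψ₀ f + g + a)}` of `V ⊕ εV`. -/
def toL (ψ₀ : D.F →ₗ[K] D.B) : D.F × D.F × D.A →ₗ[K] DualExt K V :=
  pairMap K V ∘ₗ LinearMap.prod (D.F.subtype ∘ₗ LinearMap.fst K _ _)
    (LinearMap.coprod (D.B.subtype ∘ₗ ψ₀) (LinearMap.coprod D.F.subtype D.A.subtype))

/-- The parametrisation of the subspace `(A ⊕ B) ⊕ εB` of `V ⊕ εV`. -/
def toC : D.A × D.B × D.B →ₗ[K] DualExt K V :=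
  pairMap K V ∘ₗ LinearMap.prod
    (LinearMap.coprod D.A.subtype (D.B.subtype ∘ₗ LinearMap.fst K _ _))
    (D.B.subtype ∘ₗ LinearMap.snd K _ _ ∘ₗ LinearMap.snd K _ _)

variable (ψ₀ : D.F →ₗ[K] D.B)

theorem toL_apply (x : D.F × D.F × D.A) :
    D.toL ψ₀ x = pairMap K V (x.1, ψ₀ x.1 + (x.2.1 + x.2.2)) := rfl

theorem toC_apply (y : D.A × D.B × D.B) :
    D.toC y = pairMap K V (y.1 + y.2.1, y.2.2) := rfl

/-- Matrices of linear maps between the two parameter spaces. -/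
abbrev Mat : Type _ := D.F × D.F × D.A →ₗ[K] D.A × D.B × D.B

/-- Compare the components in `F`, `A`, `B` of both coordinates; equality in `F` comes first, since
it cancels the `ψ₀` terms. -/
theorem eq_of_toL_add_toC_eq {x x' : D.F × D.F × D.A} {y y' : D.A × D.B × D.B}
    (h : D.toL ψ₀ x + D.toC y = D.toL ψ₀ x' + D.toC y') : x = x' ∧ y = y' := by
  simp only [toL_apply, toC_apply, ← map_add] at h
  have h' := pairMap_injective h
  simp only [Prod.mk_add_mk, Prod.mk.injEq] at h'
  obtain ⟨h1, h2⟩ := h'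
  have f1 := congrArg D.pF h1
  have a1 := congrArg D.pA h1
  have b1 := congrArg D.pB h1
  have f2 := congrArg D.pF h2
  have a2 := congrArg D.pA h2
  have b2 := congrArg D.pB h2
  simp at f1 a1 b1 f2 a2 b2
  rw [f1] at b2
  exact ⟨Prod.ext f1 (Prod.ext f2 a2), Prod.ext a1 (Prod.ext b1 (by simpa using b2))⟩

theorem exists_toL_add_toC (w : DualExt K V) : ∃ x y, w = D.toL ψ₀ x + D.toC y := by
  obtain ⟨v, v', rfl⟩ := exists_pairMap w
  refine ⟨(D.pF v, D.pF v', D.pA v'), (D.pA v, D.pB v, D.pB v' - ψ₀ (D.pF v)), ?_⟩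
  rw [toL_apply, toC_apply, ← map_add, Prod.mk_add_mk]
  congr 2
  · rw [← add_assoc, D.add_projections]
  · conv_lhs => rw [← D.add_projections v']
    simp only [AddSubgroupClass.coe_sub]
    abel

theorem toL_injective : Function.Injective (D.toL ψ₀) := fun x x' h =>
  (D.eq_of_toL_add_toC_eq ψ₀ (y := 0) (y' := 0) (by simp [h])).1

theorem toC_injective : Function.Injective D.toC := fun y y' h =>
  (D.eq_of_toL_add_toC_eq 0 (x := 0) (x' := 0) (by simp [h])).2

/-- The centre `{f + ε (ψ₀ f + g + a)}` of the chart. -/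
def L : Submodule K (DualExt K V) := LinearMap.range (D.toL ψ₀)

/-- The complement `(A ⊕ B) ⊕ εB` defining the chart. -/
def C : Submodule K (DualExt K V) := LinearMap.range D.toC

theorem isCompl_L_C : IsCompl (D.L ψ₀) D.C := by
  constructor
  · rw [Submodule.disjoint_def]
    rintro _ ⟨x, rfl⟩ ⟨y, hy⟩
    have := D.eq_of_toL_add_toC_eq ψ₀ (x := 0) (x' := x) (y := y) (y' := 0) (by simp [hy])
    rw [← this.1, map_zero]
  · rw [codisjoint_iff, eq_top_iff]
    intro w _
    obtain ⟨x, y, rfl⟩ := D.exists_toL_add_toC ψ₀ w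
    exact Submodule.add_mem_sup ⟨x, rfl⟩ ⟨y, rfl⟩

/-- The parametrisation of the centre of the chart. -/
def eL : (D.F × D.F × D.A) ≃ₗ[K] D.L ψ₀ := LinearEquiv.ofInjective _ (D.toL_injective ψ₀)

/-- The parametrisation of the complement defining the chart. -/
def eC : (D.A × D.B × D.B) ≃ₗ[K] D.C := LinearEquiv.ofInjective _ D.toC_injective

theorem coe_eL (x) : (D.eL ψ₀ x : DualExt K V) = D.toL ψ₀ x := rfl

theorem coe_eC (y) : (D.eC y : DualExt K V) = D.toC y := rfl

/-- The linear maps `L → C` in terms of matrices. -/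
def hom : D.Mat ≃ₗ[K] (D.L ψ₀ →ₗ[K] D.C) := LinearEquiv.arrowCongr (D.eL ψ₀) D.eC

theorem hom_apply_eL (m : D.Mat) (x) : D.hom ψ₀ m (D.eL ψ₀ x) = D.eC (m x) := by
  simp [hom]

theorem mem_grChart_hom (m : D.Mat) (w : DualExt K V) :
    w ∈ grChart (D.L ψ₀) D.C (D.hom ψ₀ m) ↔ ∃ x, D.toL ψ₀ x + D.toC (m x) = w := by
  constructor
  · rintro ⟨y, rfl⟩
    obtain ⟨x, rfl⟩ := (D.eL ψ₀).surjective y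
    refine ⟨x, ?_⟩
    rw [← coe_eL, ← coe_eC, ← hom_apply_eL]
    rfl
  · rintro ⟨x, rfl⟩
    refine ⟨D.eL ψ₀ x, ?_⟩
    rw [← coe_eL, ← coe_eC, ← hom_apply_eL]
    rfl

/-- The linear part of the parametrisation of the stratum. -/
def lin : BundleParam D.F D.A D.B →ₗ[K] D.Mat where
  toFun u := LinearMap.prod (u.1 ∘ₗ LinearMap.fst K _ _) (LinearMap.prod
    (u.2.1 ∘ₗ LinearMap.fst K _ _) (LinearMap.coprod u.2.2.2 (LinearMap.coprod u.2.1 u.2.2.1)))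
  map_add' u v := by
    refine LinearMap.ext fun x => Prod.ext ?_ (Prod.ext ?_ ?_)
    · simp
    · simp
    · simp; abel
  map_smul' t u := by
    refine LinearMap.ext fun x => Prod.ext ?_ (Prod.ext ?_ ?_) <;> simp

@[simp] theorem lin_apply (u : BundleParam D.F D.A D.B) (x : D.F × D.F × D.A) :
    D.lin u x = (u.1 x.1, u.2.1 x.1, u.2.2.2 x.1 + (u.2.1 x.2.1 + u.2.2.1 x.2.2)) := rfl

/-- The quadratic part of the parametrisation of the stratum. -/
def quad : (D.F →ₗ[K] D.B) →ₗ[K] D.Mat where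
  toFun m := LinearMap.inr K _ _ ∘ₗ LinearMap.inr K _ _ ∘ₗ (-m) ∘ₗ
    LinearMap.fst K _ _ ∘ₗ LinearMap.snd K _ _
  map_add' u v := by
    refine LinearMap.ext fun x => Prod.ext ?_ (Prod.ext ?_ ?_)
    · simp
    · simp
    · simp; abel
  map_smul' t u := by
    refine LinearMap.ext fun x => Prod.ext ?_ (Prod.ext ?_ ?_) <;> simp

@[simp] theorem quad_apply (m : D.F →ₗ[K] D.B) (x : D.F × D.F × D.A) :
    D.quad m x = (0, 0, -m x.2.1) := rfl

/-- Reading the parameters off a matrix. -/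
def read : D.Mat →ₗ[K] BundleParam D.F D.A D.B where
  toFun m := (LinearMap.fst K _ _ ∘ₗ m ∘ₗ LinearMap.inl K _ _,
    LinearMap.fst K _ _ ∘ₗ LinearMap.snd K _ _ ∘ₗ m ∘ₗ LinearMap.inl K _ _,
    LinearMap.snd K _ _ ∘ₗ LinearMap.snd K _ _ ∘ₗ m ∘ₗ LinearMap.inr K _ _ ∘ₗ LinearMap.inr K _ _,
    LinearMap.snd K _ _ ∘ₗ LinearMap.snd K _ _ ∘ₗ m ∘ₗ LinearMap.inl K _ _)
  map_add' _ _ := rfl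
  map_smul' _ _ := rfl

theorem read_fst (m : D.Mat) (f : D.F) : (D.read m).1 f = (m (f, 0, 0)).1 := rfl
theorem read_snd (m : D.Mat) (f : D.F) : (D.read m).2.1 f = (m (f, 0, 0)).2.1 := rfl
theorem read_trd (m : D.Mat) (a : D.A) : (D.read m).2.2.1 a = (m (0, 0, a)).2.2 := rfl
theorem read_fth (m : D.Mat) (f : D.F) : (D.read m).2.2.2 f = (m (f, 0, 0)).2.2 := rfl

@[simp] theorem read_lin (u : BundleParam D.F D.A D.B) : D.read (D.lin u) = u := by
  refine Prod.ext ?_ (Prod.ext ?_ (Prod.ext ?_ ?_)) <;> ext x <;>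
    simp [read_fst, read_snd, read_trd, read_fth]

@[simp] theorem read_quad (m : D.F →ₗ[K] D.B) : D.read (D.quad m) = 0 := by
  refine Prod.ext ?_ (Prod.ext ?_ (Prod.ext ?_ ?_)) <;> ext x <;>
    simp [read_fst, read_snd, read_trd, read_fth]

/-- The parameters of the centre of the chart. -/
def base : BundleParam D.F D.A D.B := (0, 0, 0, ψ₀)

/-- The matrix of the point of the stratum with given parameters. -/
def mat (u : BundleParam D.F D.A D.B) : D.Mat :=
  D.lin (u - D.base ψ₀) + D.quad (u.2.2.1 ∘ₗ u.1)

theorem mat_apply (u : BundleParam D.F D.A D.B) (x : D.F × D.F × D.A) :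
    D.mat ψ₀ u x = (u.1 x.1, u.2.1 x.1,
      u.2.2.2 x.1 - ψ₀ x.1 + (u.2.1 x.2.1 + u.2.2.1 x.2.2) - u.2.2.1 (u.1 x.2.1)) := by
  simp [mat, base, sub_eq_add_neg]
  abel

/-- The chart of the bundle is the restriction of the chart of the Grassmannian. -/
theorem toSubmodule_bundleChart (u : BundleParam D.F D.A D.B) :
    (bundleChart D.F D.A D.B D.isCompl u).toSubmodule =
      grChart (D.L ψ₀) D.C (D.hom ψ₀ (D.mat ψ₀ u)) := by
  obtain ⟨p, q, s, ψ⟩ := u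
  ext w
  obtain ⟨v, v', rfl⟩ := exists_pairMap w
  rw [FlagHom.pairMap_mem_toSubmodule, mem_grChart_hom]
  have hhom : ∀ hv : v ∈ (bundleChart D.F D.A D.B D.isCompl (p, q, s, ψ)).F,
      (bundleChart D.F D.A D.B D.isCompl (p, q, s, ψ)).hom ⟨v, hv⟩ =
        (bundleChart D.F D.A D.B D.isCompl (p, q, s, ψ)).G.mkQ v' ↔
      v' - ψ (D.pF v) ∈ LinearMap.range (D.F.subtype + D.A.subtype ∘ₗ p + D.B.subtype ∘ₗ q) ⊔
        LinearMap.range (D.A.subtype + D.B.subtype ∘ₗ s) := by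
    intro hv
    rw [eq_comm]
    exact Submodule.Quotient.eq _
  constructor
  · rintro ⟨hv, h⟩
    rw [hhom] at h
    obtain ⟨f, rfl⟩ := hv
    obtain ⟨_, ⟨g, rfl⟩, _, ⟨a, rfl⟩, h⟩ := Submodule.mem_sup.1 h
    -- The `A`-component of `(g + p g + q g) + (a + s a)` is `p g + a`. Expressing `s a` through
    -- this new coordinate produces the quadratic term `-s (p g)`.
    refine ⟨(f, g, p g + a), ?_⟩
    simp only [LinearMap.add_apply, LinearMap.comp_apply, Submodule.subtype_apply, map_add,
      pF_F, pF_A, pF_B, add_zero] at h ⊢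
    rw [toL_apply, toC_apply, mat_apply, ← map_add, Prod.mk_add_mk]
    congr 2
    · simp [add_assoc]
    · rw [eq_sub_iff_add_eq] at h
      rw [← h]
      simp
      abel
  · rintro ⟨⟨f, g, a⟩, h⟩
    rw [toL_apply, toC_apply, mat_apply, ← map_add, Prod.mk_add_mk] at h
    have h' := pairMap_injective h
    simp only [Prod.mk.injEq] at h'
    obtain ⟨rfl, rfl⟩ := h'
    have hv : (f : V) + (p f + q f) ∈ (bundleChart D.F D.A D.B D.isCompl (p, q, s, ψ)).F :=
      ⟨f, by simp [add_assoc]⟩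
    refine ⟨hv, (hhom hv).2 ?_⟩
    refine Submodule.mem_sup.2 ⟨_, ⟨g, rfl⟩, _, ⟨a - p g, rfl⟩, ?_⟩
    simp
    abel

theorem mat_base : D.mat ψ₀ (D.base ψ₀) = 0 := by
  simp [mat, base]

theorem grChart_zero {W : Type*} [AddCommGroup W] [Module K W] (L C : Submodule K W) :
    grChart L C 0 = L := by
  simp [grChart]

theorem toSubmodule_bundleChart_base :
    (bundleChart D.F D.A D.B D.isCompl (D.base ψ₀)).toSubmodule = D.L ψ₀ := by
  rw [toSubmodule_bundleChart D ψ₀, mat_base, map_zero, grChart_zero]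

/-- Every flag with a linear map is the centre of a chart. -/
theorem exists_eq_toSubmodule (x : FlagHom K V) (hF : D.F = x.F) (hG : D.F ⊔ D.A = x.G) :
    ∃ ψ₀ : D.F →ₗ[K] D.B, D.L ψ₀ = x.toSubmodule := by
  obtain ⟨F, G, hle, u⟩ := x
  dsimp only at hF hG
  subst hF hG
  obtain ⟨σ, hσ⟩ := (D.F ⊔ D.A).mkQ.exists_rightInverse_of_surjective
    (LinearMap.range_eq_top.2 (D.F ⊔ D.A).mkQ_surjective)
  -- `B` represents `V/G`: project any lift of `u f` to `B`, which changes it only by an element of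
  -- `G = F ⊕ A`.
  refine ⟨D.pB ∘ₗ σ ∘ₗ u, ?_⟩
  have key : ∀ f v, u f = (D.F ⊔ D.A).mkQ v ↔ v - D.pB (σ (u f)) ∈ D.F ⊔ D.A := by
    intro f v
    have h1 : u f = (D.F ⊔ D.A).mkQ (D.pB (σ (u f)) : V) := by
      conv_lhs => rw [← LinearMap.id_apply (R := K) (u f), ← hσ]
      rw [LinearMap.comp_apply, Submodule.mkQ_apply, Submodule.mkQ_apply, Submodule.Quotient.eq,
        mem_F_sup_A]
      simp
    conv_lhs => rw [h1, eq_comm]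
    exact Submodule.Quotient.eq _
  ext w
  obtain ⟨v, v', rfl⟩ := exists_pairMap w
  rw [FlagHom.pairMap_mem_toSubmodule]
  constructor
  · rintro ⟨⟨f, g, a⟩, h⟩
    rw [toL_apply] at h
    have h' := pairMap_injective h
    simp only [Prod.mk.injEq] at h'
    obtain ⟨rfl, rfl⟩ := h'
    refine ⟨f.2, (key _ _).2 ?_⟩
    rw [mem_F_sup_A]
    simp
  · rintro ⟨hv, h⟩
    replace h := (key _ _).1 h
    obtain ⟨g, hg, a, ha, h⟩ := Submodule.mem_sup.1 h
    refine ⟨(⟨v, hv⟩, ⟨g, hg⟩, ⟨a, ha⟩), ?_⟩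
    rw [toL_apply]
    simp [h]

/-! ### Dimension counts in a chart -/

section Dim

theorem isEpsStable_grChart_mat (u : BundleParam D.F D.A D.B) :
    IsEpsStable (grChart (D.L ψ₀) D.C (D.hom ψ₀ (D.mat ψ₀ u))) := by
  rw [← toSubmodule_bundleChart]
  exact FlagHom.isEpsStable_toSubmodule _

theorem stratumIndex_grChart_mat (u : BundleParam D.F D.A D.B) :
    stratumIndex (grChart (D.L ψ₀) D.C (D.hom ψ₀ (D.mat ψ₀ u))) = Module.finrank K D.F := by
  rw [← toSubmodule_bundleChart, stratumIndex, FlagHom.map_projV_toSubmodule]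
  refine LinearMap.finrank_range_of_inj fun f g h => ?_
  simpa using congrArg D.pF h

/-- The elements of `εV` in a subspace of the chart. -/
theorem eq_of_mem_epsPart {m : D.Mat} {v : V}
    (hv : v ∈ epsPart (grChart (D.L ψ₀) D.C (D.hom ψ₀ m))) :
    (m (0, D.pF v, D.pA v)).1 = 0 ∧ (m (0, D.pF v, D.pA v)).2.1 = 0 ∧
      (m (0, D.pF v, D.pA v)).2.2 = D.pB v := by
  rw [mem_epsPart, mem_grChart_hom] at hv
  obtain ⟨x, hx⟩ := hv
  have h2 : pairMap K V (0, v) =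
      D.toL ψ₀ (0, D.pF v, D.pA v) + D.toC (0, 0, D.pB v) := by
    rw [toL_apply, toC_apply, ← map_add, Prod.mk_add_mk]
    congr 2
    · simp
    · simp [D.add_projections]
  rw [h2] at hx
  obtain ⟨rfl, h3⟩ := D.eq_of_toL_add_toC_eq ψ₀ hx
  simp [h3]

/-- The elements of `εV` in a subspace of the chart are determined by their components in
`F ⊕ A`. -/
theorem epsPart_projections_injective (m : D.Mat) : Function.Injective
    ((D.pF.prod D.pA).domRestrict (epsPart (grChart (D.L ψ₀) D.C (D.hom ψ₀ m)))) := by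
  rw [← LinearMap.ker_eq_bot, LinearMap.ker_eq_bot']
  rintro ⟨v, hv⟩ h
  have hF : D.pF v = 0 := congrArg Prod.fst h
  have hA : D.pA v = 0 := congrArg Prod.snd h
  have h3 := (D.eq_of_mem_epsPart ψ₀ hv).2.2
  rw [hF, hA, Prod.mk_zero_zero, Prod.mk_zero_zero, map_zero] at h3
  apply Subtype.ext
  change v = 0
  rw [← D.add_projections v, hF, hA, ← h3]
  simp

variable [FiniteDimensional K V]

theorem finrank_grChart_hom (m : D.Mat) :
    Module.finrank K (grChart (D.L ψ₀) D.C (D.hom ψ₀ m)) =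
      Module.finrank K D.F + (Module.finrank K D.F + Module.finrank K D.A) := by
  have h : grChart (D.L ψ₀) D.C (D.hom ψ₀ m) = LinearMap.range (D.toL ψ₀ + D.toC ∘ₗ m) := by
    ext w
    rw [mem_grChart_hom]
    rfl
  rw [h, LinearMap.finrank_range_of_inj, Module.finrank_prod, Module.finrank_prod]
  intro x y hxy
  exact (D.eq_of_toL_add_toC_eq ψ₀ hxy).1

theorem finrank_epsPart_le (m : D.Mat) :
    Module.finrank K (epsPart (grChart (D.L ψ₀) D.C (D.hom ψ₀ m))) ≤
      Module.finrank K D.F + Module.finrank K D.A := by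
  rw [← Module.finrank_prod]
  exact LinearMap.finrank_le_finrank_of_injective (D.epsPart_projections_injective ψ₀ m)

/-- Semicontinuity: the dimension of the subspace is constant in the chart while that of `epsPart`
is at most its value at the centre, so `dim π` is at least its value there. -/
theorem finrank_F_le_stratumIndex (m : D.Mat) :
    Module.finrank K D.F ≤ stratumIndex (grChart (D.L ψ₀) D.C (D.hom ψ₀ m)) := by
  have h1 := finrank_eq_stratumIndex_add (grChart (D.L ψ₀) D.C (D.hom ψ₀ m))
  have h2 := D.finrank_epsPart_le ψ₀ m
  rw [finrank_grChart_hom] at h1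
  omega

/-- In the chart, the stratum is parametrised by an affine space. -/
theorem exists_mat_eq {m : D.Mat} (hε : IsEpsStable (grChart (D.L ψ₀) D.C (D.hom ψ₀ m)))
    (hi : stratumIndex (grChart (D.L ψ₀) D.C (D.hom ψ₀ m)) = Module.finrank K D.F) :
    m = D.mat ψ₀ (D.read m + D.base ψ₀) := by
  have h1 := finrank_eq_stratumIndex_add (grChart (D.L ψ₀) D.C (D.hom ψ₀ m))
  rw [finrank_grChart_hom, hi] at h1
  -- Equal index forces equal dimensions, so the injective projection of `epsPart` to `F ⊕ A` is
  -- onto. Every `(g, a)` then comes from an element of `εV`, which has no component along `A ⊕ B`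
  -- in the first coordinate.
  have hsurj : ∀ (g : D.F) (a : D.A), (m (0, g, a)).1 = 0 ∧ (m (0, g, a)).2.1 = 0 := by
    intro g a
    let φ := (D.pF.prod D.pA).domRestrict (epsPart (grChart (D.L ψ₀) D.C (D.hom ψ₀ m)))
    have hs : Function.Surjective φ :=
      (LinearMap.injective_iff_surjective_of_finrank_eq_finrank
        (by rw [Module.finrank_prod]; omega)).1
        (D.epsPart_projections_injective ψ₀ m)
    obtain ⟨⟨v, hv⟩, h⟩ := hs (g, a)
    have h2 := D.eq_of_mem_epsPart ψ₀ hv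
    have hg : D.pF v = g := congrArg Prod.fst h
    have ha : D.pA v = a := congrArg Prod.snd h
    rw [hg, ha] at h2
    exact ⟨h2.1, h2.2.1⟩
  -- Multiplying the graph point over `f` by `ε` puts `f + p f + q f` into `epsPart`; its
  -- `B`-component `q f` must be the value of the matrix at `(0, f, p f)`.
  have hq : ∀ f : D.F, (m (0, f, (m (f, 0, 0)).1)).2.2 = (m (f, 0, 0)).2.1 := by
    intro f
    have h2 := hε _ ((D.mem_grChart_hom ψ₀ m _).2 ⟨(f, 0, 0), rfl⟩)
    rw [toL_apply, toC_apply, ← map_add, eps_smul_pairMap, ← mem_epsPart] at h2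
    have h3 := (D.eq_of_mem_epsPart ψ₀ h2).2.2
    simpa using h3
  refine LinearMap.ext fun x => ?_
  obtain ⟨f, g, a⟩ := x
  -- Arranged so that the relation just found applies to `(0, g, p g)`; the subtracted term is `s (p
  -- g)`.
  have e0 : m (f, g, a) = m (f, 0, 0) + (m (0, g, (m (g, 0, 0)).1) +
      m (0, 0, a) - m (0, 0, (m (g, 0, 0)).1)) := by
    rw [← map_add, ← map_sub, ← map_add]
    simp
  rw [mat_apply]
  have z1 := hsurj g a
  have e1 : m (f, g, a) = m (f, 0, 0) + m (0, g, a) := by rw [← map_add]; simp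
  refine Prod.ext ?_ (Prod.ext ?_ ?_)
  · rw [e1]
    simp [z1.1, base, read_fst]
  · rw [e1]
    simp [z1.2, base, read_snd]
  · rw [e0]
    simp [base, read_fst, read_snd, read_trd, read_fth, hq]
    abel

theorem grChart_mat_mem_sigmaStratum {n i : ℕ} (hi : Module.finrank K D.F = i)
    (hn : Module.finrank K D.F + (Module.finrank K D.F + Module.finrank K D.A) = n)
    (u : BundleParam D.F D.A D.B) :
    grChart (D.L ψ₀) D.C (D.hom ψ₀ (D.mat ψ₀ u)) ∈ sigmaStratum K V n i :=
  ⟨by rw [finrank_grChart_hom, hn], D.isEpsStable_grChart_mat ψ₀ u,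
    by rw [stratumIndex_grChart_mat, hi]⟩

end Dim

end Splitting

/-- The decomposition obtained from a complement `B` of `F ⊕ A`. -/
def Splitting.ofIsCompl {K : Type*} [Field K] {V : Type*} [AddCommGroup V] [Module K V]
    (F A B : Submodule K V) (hFA : Disjoint F A) (hB : IsCompl (F ⊔ A) B) : Splitting K V where
  F := F
  A := A
  B := B
  isCompl := ⟨hFA.disjoint_sup_right_of_disjoint_sup_left hB.disjoint, by
    rw [codisjoint_iff, ← sup_assoc, hB.sup_eq_top]⟩
  disjoint := hB.disjoint.mono_left le_sup_right

theorem FlagHom.exists_splitting {K : Type*} [Field K] {V : Type*} [AddCommGroup V] [Module K V]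
    (x : FlagHom K V) : ∃ D : Splitting K V, D.F = x.F ∧ D.F ⊔ D.A = x.G := by
  obtain ⟨A', hA'⟩ := x.F.exists_isCompl
  obtain ⟨B, hB⟩ := x.G.exists_isCompl
  have hG : x.F ⊔ A' ⊓ x.G = x.G := by
    rw [← sup_inf_assoc_of_le _ x.le, hA'.sup_eq_top, top_inf_eq]
  exact ⟨Splitting.ofIsCompl x.F (A' ⊓ x.G) B (hA'.disjoint.mono_right inf_le_left)
    (by rwa [hG]), rfl, hG⟩

/-! ### The bundle over the flag variety is embedded -/

namespace Splitting

variable {K : Type*} [Field K] {V : Type*} [AddCommGroup V] [Module K V] (D : Splitting K V)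
  (ψ₀ : D.F →ₗ[K] D.B)

theorem read_mat (u : BundleParam D.F D.A D.B) : D.read (D.mat ψ₀ u) + D.base ψ₀ = u := by
  simp [mat]

theorem isPolyMap_read : IsPolyMap K fun φ => D.read ((D.hom ψ₀).symm φ) + D.base ψ₀ :=
  (IsPolyMap.linear (D.read ∘ₗ (D.hom ψ₀).symm.toLinearMap)).add (IsPolyMap.const _)

variable [FiniteDimensional K V]

theorem isPolyMap_comp_parts {P : Type*} [AddCommGroup P] [Module K P]
    (p : P →ₗ[K] BundleParam D.F D.A D.B) :
    IsPolyMap K fun u : P => (p u).2.2.1 ∘ₗ (p u).1 :=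
  IsPolyMap.bilin (LinearMap.llcomp K D.F D.A D.B)
    (IsPolyMap.linear (LinearMap.fst K _ _ ∘ₗ LinearMap.snd K _ _ ∘ₗ LinearMap.snd K _ _ ∘ₗ p))
    (IsPolyMap.linear (LinearMap.fst K _ _ ∘ₗ p))

theorem isPolyMap_mat : IsPolyMap K fun u => D.hom ψ₀ (D.mat ψ₀ u) := by
  have h : IsPolyMap K (D.mat ψ₀) := by
    have h1 := (IsPolyMap.linear (K := K) D.lin).add (IsPolyMap.const (-D.lin (D.base ψ₀)))
    have h2 := (D.isPolyMap_comp_parts LinearMap.id).linear_comp D.quad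
    have h3 := h1.add h2
    convert h3 using 2 with u
    simp [mat, sub_eq_add_neg]
  exact h.linear_comp (D.hom ψ₀).toLinearMap

end Splitting

section Embedding

variable {K : Type*} [Field K] {V : Type*} [AddCommGroup V] [Module K V] [FiniteDimensional K V]

/-- Around each point the chart of the Grassmannian centred at its image is used. Its preimage is
exactly one bundle chart, because `exists_mat_eq` recovers the parameters of any point of the
stratum in it. -/
theorem isBundleEmbedding (n i : ℕ) : IsBundleEmbedding K V n i := by
  refine ⟨FlagHom.toSubmodule_injective.injOn, fun x hx => ?_⟩
  obtain ⟨D, hF, hG⟩ := x.exists_splitting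
  obtain ⟨ψ₀, hψ⟩ := D.exists_eq_toSubmodule x hF hG
  have hxD : bundleChart D.F D.A D.B D.isCompl (D.base ψ₀) = x :=
    FlagHom.toSubmodule_injective (by rw [D.toSubmodule_bundleChart_base, hψ])
  have hxs : x.toSubmodule ∈ sigmaStratum K V n i := by
    rw [← image_flagBundle]
    exact ⟨x, hx, rfl⟩
  have hFi : Module.finrank K D.F = i := by rw [hF]; exact hx.1
  have hn : Module.finrank K D.F + (Module.finrank K D.F + Module.finrank K D.A) = n := by
    rw [← hxs.1, ← hxD, D.toSubmodule_bundleChart ψ₀, D.finrank_grChart_hom]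
  have hmem : ∀ u, bundleChart D.F D.A D.B D.isCompl u ∈ flagBundle K V n i := by
    intro u
    have h := D.grChart_mat_mem_sigmaStratum ψ₀ hFi hn u
    rw [← D.toSubmodule_bundleChart, ← image_flagBundle] at h
    obtain ⟨y, hy, hyu⟩ := h
    rwa [← FlagHom.toSubmodule_injective hyu]
  refine ⟨D.F, D.A, D.B, D.isCompl, D.disjoint, ⟨_, hxD⟩, D.L ψ₀, D.C, D.isCompl_L_C ψ₀, ?_,
    fun u => D.hom ψ₀ (D.mat ψ₀ u), fun φ => D.read ((D.hom ψ₀).symm φ) + D.base ψ₀,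
    D.isPolyMap_mat ψ₀, D.isPolyMap_read ψ₀, fun u => ?_, D.toSubmodule_bundleChart ψ₀⟩
  · ext y
    constructor
    · rintro ⟨u, rfl⟩
      exact ⟨hmem u, _, (D.toSubmodule_bundleChart ψ₀ u).symm⟩
    · rintro ⟨hy, φ, hφ⟩
      obtain ⟨m, rfl⟩ := (D.hom ψ₀).surjective φ
      have hys : y.toSubmodule ∈ sigmaStratum K V n i := by
        rw [← image_flagBundle]
        exact ⟨y, hy, rfl⟩
      rw [← hφ] at hys
      have hm := D.exists_mat_eq ψ₀ hys.2.1 (by rw [hys.2.2, hFi])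
      refine ⟨D.read m + D.base ψ₀, FlagHom.toSubmodule_injective ?_⟩
      rw [D.toSubmodule_bundleChart ψ₀, ← hm, hφ]
  · simp [D.read_mat]

end Embedding

/-! ### Equations for tangent vectors -/

section TangentEquations

variable {K : Type*} [Field K] {V : Type*} [AddCommGroup V] [Module K V]
  {L C : Submodule K (DualExt K V)}

/-- A tangent vector `L → C` which is `ε`-linear modulo `L`. -/
def IsEpsTangent (φ : L →ₗ[K] C) : Prop :=
  ∀ x y : L, (y : DualExt K V) = (DualNumber.eps : DualNumber K) • (x : DualExt K V) →
    (DualNumber.eps : DualNumber K) • (φ x : DualExt K V) - φ y ∈ L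

/-- A tangent vector `L → C` in whose direction the dimension of `π(L)` does not grow. -/
def IsRankTangent (φ : L →ₗ[K] C) : Prop :=
  ∀ x : L, projV K V x = 0 → projV K V (φ x) ∈ L.map (projV K V)

/-- A tangent vector `L → C` in whose direction `L` stays isotropic. -/
def IsSkewTangent (β : LinearMap.BilinForm K (DualExt K V)) (φ : L →ₗ[K] C) : Prop :=
  ∀ x y : L, β (φ x) y + β x (φ y) = 0

theorem mem_grChart_iff {W : Type*} [AddCommGroup W] [Module K W] {L C : Submodule K W}
    (hLC : IsCompl L C) (φ : L →ₗ[K] C) (w : W) :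
    w ∈ grChart L C φ ↔ C.projectionOnto L hLC.symm w = φ (L.projectionOnto C hLC w) := by
  constructor
  · rintro ⟨x, rfl⟩
    simp
  · intro h
    refine ⟨L.projectionOnto C hLC w, ?_⟩
    simp only [LinearMap.add_apply, LinearMap.comp_apply, Submodule.subtype_apply, ← h]
    simpa using Submodule.projection_add_projection_eq_self hLC w

variable {S : Set (Submodule K (DualExt K V))} {h0 : (0 : L →ₗ[K] C) ∈ grChart L C ⁻¹' S}
  {φ : L →ₗ[K] C}

variable (K V) in
/-- Multiplication by `ε` as a `K`-linear map. -/
def epsLin : DualExt K V →ₗ[K] DualExt K V := (epsMul K (DualExt K V)).restrictScalars K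

theorem epsLin_apply (w : DualExt K V) :
    epsLin K V w = (DualNumber.eps : DualNumber K) • w := rfl

theorem add_mem_grChart {W : Type*} [AddCommGroup W] [Module K W] {L C : Submodule K W}
    (φ : L →ₗ[K] C) (x : L) : (x : W) + φ x ∈ grChart L C φ := ⟨x, rfl⟩

/-- The subspace with chart coordinate `z` projects to the range of `π ∘ (id + z)` on `L`, so the
index bound is a rank bound for a family affine in `z`. -/
theorem isRankTangent_of_mem [FiniteDimensional K V]
    (hφ : φ ∈ affineTangentSpace K (⟨0, h0⟩ : grChart L C ⁻¹' S))
    (hS : ∀ L' ∈ S, stratumIndex L' ≤ stratumIndex L) : IsRankTangent φ := by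
  intro x hx
  let α : (L →ₗ[K] C) →ₗ[K] L →ₗ[K] V := LinearMap.llcomp K L C V (projV K V ∘ₗ C.subtype)
  have := map_mem_range_of_mem_affineTangentSpace hφ (projV K V ∘ₗ L.subtype) α ?_ x hx
  · rw [LinearMap.range_comp, Submodule.range_subtype] at this
    exact this
  · intro z hz
    have h := hS _ hz
    rw [stratumIndex, stratumIndex, grChart, ← LinearMap.range_comp] at h
    have h2 : LinearMap.range (projV K V ∘ₗ L.subtype) = L.map (projV K V) := by
      rw [LinearMap.range_comp, Submodule.range_subtype]
    rw [h2]
    rwa [LinearMap.comp_add] at h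

variable [FiniteDimensional K V]

theorem isEpsTangent_of_mem (hLC : IsCompl L C)
    (hφ : φ ∈ affineTangentSpace K (⟨0, h0⟩ : grChart L C ⁻¹' S))
    (hS : ∀ L' ∈ S, IsEpsStable L') : IsEpsTangent φ := by
  intro x y hxy
  let pC := C.projectionOnto L hLC.symm
  let pL := L.projectionOnto C hLC
  suffices h : pC (epsLin K V (φ x)) - φ y = 0 by
    have h2 : pC (epsLin K V (φ x) - φ y) = 0 := by
      rw [map_sub, Submodule.projectionOnto_apply_left, h]
    exact (Submodule.projectionOnto_apply_eq_zero_iff hLC.symm).1 h2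
  -- Testing with functionals `μ` on `C` turns stability of the graph of `z` into scalar equations:
  -- the `C`-part of `ε(x + z x)` equals `z` of its `L`-part, a linear term plus a quadratic one.
  refine (Module.forall_dual_apply_eq_zero_iff K _).1 fun μ => ?_
  let l : Module.Dual K (L →ₗ[K] C) := μ ∘ₗ
    ((pC ∘ₗ epsLin K V ∘ₗ C.subtype) ∘ₗ LinearMap.applyₗ x - LinearMap.applyₗ y)
  let B : (L →ₗ[K] C) →ₗ[K] Module.Dual K (L →ₗ[K] C) := LinearMap.mk₂ K
    (fun z z' => -μ (z (pL (epsLin K V (z' x)))))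
    (fun _ _ _ => by simp; abel) (fun _ _ _ => by simp)
    (fun _ _ _ => by simp; abel) (fun _ _ _ => by simp)
  refine linear_eq_zero_of_mem_affineTangentSpace hφ l B fun z hz => ?_
  have h1 := hS _ hz _ (add_mem_grChart z x)
  rw [mem_grChart_iff hLC, smul_add, ← hxy, ← epsLin_apply, map_add, map_add,
    Submodule.projectionOnto_apply_left, Submodule.projectionOnto_apply_right, zero_add,
    map_add] at h1
  change μ (pC (epsLin K V (z x)) - z y) + -μ (z (pL (epsLin K V (z x)))) = 0
  rw [h1, ← map_neg, ← map_add]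
  convert map_zero μ
  abel

/-- Expanding `β(x + z x, y + z y) = 0` leaves a linear and a quadratic term in `z`, the constant
term vanishing because `L` itself lies in `S`. -/
theorem isSkewTangent_of_mem (β : LinearMap.BilinForm K (DualExt K V))
    (hφ : φ ∈ affineTangentSpace K (⟨0, h0⟩ : grChart L C ⁻¹' S))
    (hS : ∀ L' ∈ S, ∀ x ∈ L', ∀ y ∈ L', β x y = 0) : IsSkewTangent β φ := by
  intro x y
  let l : Module.Dual K (L →ₗ[K] C) := (β.flip y ∘ₗ C.subtype) ∘ₗ LinearMap.applyₗ x +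
    (β x ∘ₗ C.subtype) ∘ₗ LinearMap.applyₗ y
  let B : (L →ₗ[K] C) →ₗ[K] Module.Dual K (L →ₗ[K] C) := LinearMap.mk₂ K
    (fun z z' => β (z x) (z' y))
    (fun _ _ _ => by simp) (fun _ _ _ => by simp) (fun _ _ _ => by simp) (fun _ _ _ => by simp)
  refine linear_eq_zero_of_mem_affineTangentSpace hφ l B fun z hz => ?_
  have h1 := hS _ hz _ (add_mem_grChart z x) _ (add_mem_grChart z y)
  have h2 : L ∈ S := by
    have := h0
    rwa [Set.mem_preimage, Splitting.grChart_zero] at this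
  have h3 := hS _ h2 x x.2 y y.2
  simp only [map_add, LinearMap.add_apply, h3, zero_add] at h1
  change β (z x) y + β x (z y) + β (z x) (z y) = 0
  rw [← h1]
  ring

end TangentEquations

/-! ### Tangent vectors as `K[ε]`-linear maps -/

section Forget

variable {K : Type*} [Field K]

theorem dualNumber_smul_eq {M : Type*} [AddCommGroup M] [Module K M] [Module (DualNumber K) M]
    [IsScalarTower K (DualNumber K) M] (c : DualNumber K) (x : M) :
    c • x = c.fst • x + c.snd • (DualNumber.eps : DualNumber K) • x := by
  have h : c = c.fst • (1 : DualNumber K) + c.snd • DualNumber.eps := by ext <;> simp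
  conv_lhs => rw [h]
  rw [add_smul, smul_assoc, smul_assoc, one_smul]

theorem mem_homZero_iff {M N : Type*} [AddCommGroup M] [Module (DualNumber K) M]
    [AddCommGroup N] [Module (DualNumber K) N] (φ : M →ₗ[DualNumber K] N) :
    inducedZero φ = 0 ↔ ∀ x : M, (DualNumber.eps : DualNumber K) • x = 0 →
      ∃ y : N, (DualNumber.eps : DualNumber K) • y = φ x := by
  constructor
  · intro h x hx
    have h1 := DFunLike.congr_fun h (Submodule.Quotient.mk ⟨x, hx⟩)
    exact (Submodule.Quotient.mk_eq_zero ((filOne K N).submoduleOf (filTwo K N))).1 h1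
  · intro h
    ext ⟨x, hx⟩
    exact (Submodule.Quotient.mk_eq_zero ((filOne K N).submoduleOf (filTwo K N))).2 (h x hx)

variable {V : Type*} [AddCommGroup V] [Module K V] {L : Submodule (DualNumber K) (DualExt K V)}
  {C : Submodule K (DualExt K V)}

theorem forgetHom_eq_iff (φ : L →ₗ[DualNumber K] DualExt K V ⧸ L)
    (φ' : L.restrictScalars K →ₗ[K] C) :
    forgetHom L φ = (L.restrictScalars K).mkQ ∘ₗ C.subtype ∘ₗ φ' ↔
      ∀ x (hx : x ∈ L), φ ⟨x, hx⟩ = L.mkQ (φ' ⟨x, hx⟩) := by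
  constructor
  · intro h x hx
    have h1 := congrArg (Submodule.Quotient.restrictScalarsEquiv K L)
      (DFunLike.congr_fun h ⟨x, hx⟩)
    simp only [forgetHom, LinearMap.comp_apply, LinearEquiv.coe_coe,
      LinearEquiv.apply_symm_apply] at h1
    exact h1
  · intro h
    ext ⟨x, hx⟩
    apply (Submodule.Quotient.restrictScalarsEquiv K L).injective
    simp only [forgetHom, LinearMap.comp_apply, LinearEquiv.coe_coe,
      LinearEquiv.apply_symm_apply]
    exact h x hx

theorem exists_forgetHom_eq {φ' : L.restrictScalars K →ₗ[K] C} (hφ : IsEpsTangent φ') :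
    ∃ φ : L →ₗ[DualNumber K] DualExt K V ⧸ L,
      forgetHom L φ = (L.restrictScalars K).mkQ ∘ₗ C.subtype ∘ₗ φ' := by
  have hadd : ∀ x y : L.restrictScalars K,
      L.mkQ (φ' (x + y)) = L.mkQ (φ' x) + L.mkQ (φ' y) := fun x y => by simp
  have hsmul : ∀ (c : K) (x : L.restrictScalars K),
      L.mkQ (φ' (c • x)) = c • L.mkQ (φ' x) := fun c x => by simp
  refine ⟨{ toFun := fun x => L.mkQ (φ' x), map_add' := hadd, map_smul' := fun c x => ?_ },
    (forgetHom_eq_iff _ _).2 fun x hx => rfl⟩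
  have h2 : L.mkQ (φ' (((DualNumber.eps : DualNumber K) • x : L) : L.restrictScalars K)) =
      (DualNumber.eps : DualNumber K) • L.mkQ (φ' x) := by
    rw [← map_smul, eq_comm]
    exact (Submodule.Quotient.eq L).2 (hφ x _ rfl)
  have h1 : (c • x : L) = c.fst • x + c.snd • ((DualNumber.eps : DualNumber K) • x) :=
    dualNumber_smul_eq c x
  rw [h1]
  refine (hadd _ _).trans ?_
  erw [hsmul, hsmul, h2]
  exact (dualNumber_smul_eq c (L.mkQ (φ' x) : DualExt K V ⧸ L)).symm

theorem isEpsTangent_of_forgetHom_eq {φ : L →ₗ[DualNumber K] DualExt K V ⧸ L}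
    {φ' : L.restrictScalars K →ₗ[K] C}
    (h : forgetHom L φ = (L.restrictScalars K).mkQ ∘ₗ C.subtype ∘ₗ φ') : IsEpsTangent φ' := by
  rw [forgetHom_eq_iff] at h
  rintro ⟨x, hx⟩ ⟨y, hy⟩ hxy
  dsimp only at hxy
  subst hxy
  have h1 := h _ hy
  have h2 : (⟨(DualNumber.eps : DualNumber K) • x, hy⟩ : L) =
      (DualNumber.eps : DualNumber K) • ⟨x, hx⟩ := rfl
  rw [h2, map_smul, h x hx, ← map_smul] at h1
  exact (Submodule.Quotient.eq L).1 h1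

/-- The kernel of `ε` on `L` is `L ∩ εV`, and the image of `ε` on the quotient is `(εV + L)/L`.
Membership of `φ' x` in `εV + L` says that `π(φ' x)` lies in `π(L)`. -/
theorem inducedZero_eq_zero_iff {φ : L →ₗ[DualNumber K] DualExt K V ⧸ L}
    {φ' : L.restrictScalars K →ₗ[K] C}
    (h : forgetHom L φ = (L.restrictScalars K).mkQ ∘ₗ C.subtype ∘ₗ φ') :
    inducedZero φ = 0 ↔ IsRankTangent φ' := by
  rw [mem_homZero_iff]
  rw [forgetHom_eq_iff] at h
  have heps : ∀ x : L, (DualNumber.eps : DualNumber K) • x = 0 ↔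
      projV K V (x : DualExt K V) = 0 := by
    intro x
    rw [← Submodule.coe_eq_zero, Submodule.coe_smul, eps_smul_eq]
    constructor
    · intro h
      have := congrArg (imV K V) h
      simpa using this
    · intro h
      rw [h]
      exact map_zero _
  constructor
  · rintro H ⟨x, hx⟩ h0
    obtain ⟨y, hy⟩ := H ⟨x, hx⟩ ((heps _).2 h0)
    obtain ⟨w, rfl⟩ := L.mkQ_surjective y
    rw [h x hx, ← map_smul] at hy
    have hy' := (Submodule.Quotient.eq L).1 hy.symm
    refine ⟨_, hy', ?_⟩
    rw [map_sub, eps_smul_eq, projV_pairMap, sub_zero]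
  · rintro H ⟨x, hx⟩ h0
    obtain ⟨w, hw, hwx⟩ := H ⟨x, hx⟩ ((heps _).1 h0)
    refine ⟨L.mkQ (pairMap K V (imV K V (φ' ⟨x, hx⟩ - w), 0)), ?_⟩
    rw [h x hx, ← map_smul, eps_smul_pairMap]
    refine (Submodule.Quotient.eq L).2 ?_
    have h2 : pairMap K V (0, imV K V (φ' ⟨x, hx⟩ - w)) = φ' ⟨x, hx⟩ - w := by
      conv_rhs => rw [← pairMap_projV_imV ((φ' ⟨x, hx⟩ : DualExt K V) - w)]
      rw [map_sub (projV K V), hwx, sub_self]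
    have h3 : pairMap K V (0, imV K V (φ' ⟨x, hx⟩ - w)) - φ' ⟨x, hx⟩ = -w := by
      rw [h2]; abel
    have h4 : pairMap K V (0, imV K V (φ' ⟨x, hx⟩ - w)) - φ' ⟨x, hx⟩ ∈ L := by
      rw [h3]; exact L.neg_mem hw
    exact h4

theorem exists_lift_of_isCompl {W : Type*} [AddCommGroup W] [Module K W] {L C : Submodule K W}
    (hLC : IsCompl L C) (ξ : L →ₗ[K] W ⧸ L) :
    ∃ φ' : L →ₗ[K] C, ξ = L.mkQ ∘ₗ C.subtype ∘ₗ φ' := by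
  refine ⟨(Submodule.quotientEquivOfIsCompl L C hLC).toLinearMap ∘ₗ ξ, ?_⟩
  ext x
  obtain ⟨w, hw⟩ := L.mkQ_surjective (ξ x)
  have := (Submodule.quotientEquivOfIsCompl L C hLC).symm_apply_apply (ξ x)
  rw [Submodule.quotientEquivOfIsCompl_symm_apply] at this
  exact this.symm

end Forget

/-! ### Tangent vectors in the charts attached to splittings -/

namespace Splitting

variable {K : Type*} [Field K] {V : Type*} [AddCommGroup V] [Module K V] (D : Splitting K V)
  (ψ₀ : D.F →ₗ[K] D.B)

/-- Linearised form of `exists_mat_eq`: the rank condition kills the `A ⊕ B` entries on `L ∩ εV`,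
and `ε`-linearity identifies the `εB` entry on `εF` with `q`. -/
theorem eq_lin_of_isTangent {m : D.Mat} (hE : IsEpsTangent (D.hom ψ₀ m))
    (hR : IsRankTangent (D.hom ψ₀ m)) : m = D.lin (D.read m) := by
  have h1 : ∀ (g : D.F) (a : D.A), (m (0, g, a)).1 = 0 ∧ (m (0, g, a)).2.1 = 0 := by
    intro g a
    have := hR (D.eL ψ₀ (0, g, a)) (by rw [coe_eL, toL_apply, projV_pairMap]; rfl)
    rw [hom_apply_eL, coe_eC, toC_apply, projV_pairMap] at this
    obtain ⟨_, ⟨x, rfl⟩, hx⟩ := this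
    rw [toL_apply, projV_pairMap] at hx
    have ha := congrArg D.pA hx
    have hb := congrArg D.pB hx
    simp at ha hb
    exact ⟨ha.symm, hb.symm⟩
  have h2 : ∀ f : D.F, (m (0, f, 0)).2.2 = (m (f, 0, 0)).2.1 := by
    intro f
    have := hE (D.eL ψ₀ (f, 0, 0)) (D.eL ψ₀ (0, f, 0)) (by
      rw [coe_eL, coe_eL, toL_apply, toL_apply, eps_smul_pairMap]
      simp)
    rw [hom_apply_eL, coe_eC, hom_apply_eL, coe_eC, toC_apply, toC_apply, eps_smul_pairMap,
      ← map_sub, Prod.mk_sub_mk] at this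
    obtain ⟨x, hx⟩ := this
    rw [toL_apply] at hx
    have hx' := pairMap_injective hx
    simp only [Prod.mk.injEq] at hx'
    have hf := congrArg D.pF hx'.1
    simp [(h1 f 0).1, (h1 f 0).2] at hf
    have hb := congrArg D.pB hx'.2
    simp [hf] at hb
    exact (sub_eq_zero.1 hb.symm).symm
  refine LinearMap.ext fun x => ?_
  obtain ⟨f, g, a⟩ := x
  have e0 : m (f, g, a) = m (f, 0, 0) + (m (0, g, 0) + m (0, 0, a)) := by
    rw [← map_add, ← map_add]
    simp
  rw [e0, lin_apply]
  refine Prod.ext ?_ (Prod.ext ?_ ?_)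
  · simp [h1, read_fst]
  · simp [h1, read_snd]
  · simp [h2, read_fth, read_trd, read_snd]

/-- At the centre both `p` and `s` vanish, so `s ∘ p` is of order `t ^ 2` and the velocity is `lin
w`. -/
theorem mat_base_add_smul (w : BundleParam D.F D.A D.B) (t : K) :
    D.mat ψ₀ (D.base ψ₀ + t • w) =
      t • D.lin w + t ^ 2 • D.quad (w.2.2.1 ∘ₗ w.1) := by
  have h : (D.base ψ₀ + t • w).2.2.1 ∘ₗ (D.base ψ₀ + t • w).1 = t ^ 2 • (w.2.2.1 ∘ₗ w.1) := by
    ext x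
    simp [base, smul_smul, pow_two]
  rw [mat, add_sub_cancel_left, h, map_smul, map_smul]

theorem exists_chart_sigmaStratum [Infinite K] [FiniteDimensional K V] {n i : ℕ}
    (hL : D.L ψ₀ ∈ sigmaStratum K V n i) :
    ∃ C : Submodule K (DualExt K V), IsCompl (D.L ψ₀) C ∧
      ∃ h : (0 : D.L ψ₀ →ₗ[K] C) ∈ grChart (D.L ψ₀) C ⁻¹' sigmaStratum K V n i,
        ∀ φ : D.L ψ₀ →ₗ[K] C, IsEpsTangent φ → IsRankTangent φ →
          φ ∈ affineTangentSpace K (⟨0, h⟩ : grChart (D.L ψ₀) C ⁻¹' sigmaStratum K V n i) := by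
  have h0 : (0 : D.L ψ₀ →ₗ[K] D.C) ∈ grChart (D.L ψ₀) D.C ⁻¹' sigmaStratum K V n i := by
    rwa [Set.mem_preimage, grChart_zero]
  refine ⟨D.C, D.isCompl_L_C ψ₀, h0, fun φ hE hR => ?_⟩
  obtain ⟨m, rfl⟩ := (D.hom ψ₀).surjective φ
  have hm := D.eq_lin_of_isTangent ψ₀ hE hR
  have hn := D.finrank_grChart_hom ψ₀ (D.mat ψ₀ (D.base ψ₀))
  have hi := D.stratumIndex_grChart_mat ψ₀ (D.base ψ₀)
  rw [mat_base, map_zero, grChart_zero] at hn hi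
  rw [hL.1] at hn
  rw [hL.2.2] at hi
  refine mem_affineTangentSpace_of_curve _ _
    (D.hom ψ₀ (D.quad ((D.read m).2.2.1 ∘ₗ (D.read m).1))) fun t => ?_
  have := D.grChart_mat_mem_sigmaStratum ψ₀ hi.symm hn.symm (D.base ψ₀ + t • D.read m)
  rw [mat_base_add_smul, ← hm, map_add, map_smul, map_smul] at this
  rw [zero_add]
  exact this

end Splitting

/-- The conditions on a tangent vector are necessary in every chart centred at `L`; sufficiency is
checked in the one chart coming from a splitting adapted to the flag of `L`. -/
theorem grTangentSpace_sigmaStratum {K : Type*} [Field K] [Infinite K] {V : Type*}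
    [AddCommGroup V] [Module K V] [FiniteDimensional K V] {n i : ℕ}
    (L : Submodule (DualNumber K) (DualExt K V))
    (hL : L.restrictScalars K ∈ sigmaStratum K V n i) :
    grTangentSpace (sigmaStratum K V n i) (L.restrictScalars K) =
      forgetHom L '' homZero K L (DualExt K V ⧸ L) := by
  ext ξ
  constructor
  · rintro ⟨C, hC, h0, φ', hφ', rfl⟩
    obtain ⟨φ, hφ⟩ := exists_forgetHom_eq (isEpsTangent_of_mem hC hφ' fun L' h => h.2.1)
    refine ⟨φ, ?_, hφ⟩
    exact (inducedZero_eq_zero_iff hφ).2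
      (isRankTangent_of_mem hφ' fun L' h => by rw [h.2.2, hL.2.2])
  · rintro ⟨φ, hφ, rfl⟩
    obtain ⟨x, hx⟩ := hL.2.1.exists_flagHom
    obtain ⟨D, hF, hG⟩ := x.exists_splitting
    obtain ⟨ψ₀, hψ⟩ := D.exists_eq_toSubmodule x hF hG
    rw [hx] at hψ
    have key := D.exists_chart_sigmaStratum ψ₀ (n := n) (i := i)
    rw [hψ] at key
    obtain ⟨C, hC, h0, key⟩ := key hL
    obtain ⟨φ', hφ'⟩ := exists_lift_of_isCompl hC (forgetHom L φ)
    exact ⟨C, hC, h0, φ', key φ' (isEpsTangent_of_forgetHom_eq hφ')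
      ((inducedZero_eq_zero_iff hφ').1 hφ), hφ'⟩

/-! ### The `ε`-component of the extended form -/

section Form

variable {K : Type*} [Field K] {V : Type*} [AddCommGroup V] [Module K V]
  (b : LinearMap.BilinForm K V)

/-- The `ε`-component of the `K[ε]`-bilinear extension of `b`. -/
def imForm : LinearMap.BilinForm K (DualExt K V) :=
  b.compl₁₂ (projV K V) (imV K V) + b.compl₁₂ (imV K V) (projV K V)

theorem imForm_pairMap (x y : V × V) :
    imForm b (pairMap K V x) (pairMap K V y) = b x.1 y.2 + b x.2 y.1 := by
  simp [imForm]

theorem snd_extForm (x y : DualExt K V) : (extForm b x y).snd = imForm b x y := by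
  obtain ⟨a, a', rfl⟩ := exists_pairMap x
  obtain ⟨c, c', rfl⟩ := exists_pairMap y
  rw [extForm_pairMap, imForm_pairMap]
  simp

variable {b}

theorem imForm_comm (hs : b.IsSymm) (x y : DualExt K V) : imForm b x y = imForm b y x := by
  obtain ⟨a, a', rfl⟩ := exists_pairMap x
  obtain ⟨c, c', rfl⟩ := exists_pairMap y
  rw [imForm_pairMap, imForm_pairMap, hs.eq c, hs.eq c', add_comm]

theorem imForm_nondegenerate (hs : b.IsSymm) (hb : b.Nondegenerate) :
    (imForm b).Nondegenerate := by
  have h : (imForm b).SeparatingLeft := by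
    intro x hx
    obtain ⟨a, a', rfl⟩ := exists_pairMap x
    have h1 : a = 0 := hb.1 a fun y => by
      simpa [imForm_pairMap] using hx (pairMap K V (0, y))
    have h2 : a' = 0 := hb.1 a' fun y => by
      simpa [imForm_pairMap] using hx (pairMap K V (y, 0))
    rw [h1, h2]
    exact map_zero _
  refine ⟨h, fun y hy => h y fun x => ?_⟩
  rw [imForm_comm hs]
  exact hy x

/-- The scalar part of `ψ x` is the `ε`-component of `ψ (ε x)`. -/
theorem dual_eq_zero_of_snd_eq_zero {M : Type*} [AddCommGroup M] [Module (DualNumber K) M]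
    (ψ : Module.Dual (DualNumber K) M) (h : ∀ x, (ψ x).snd = 0) : ψ = 0 := by
  refine LinearMap.ext fun x => TrivSqZeroExt.ext ?_ (h x)
  have h1 := h ((DualNumber.eps : DualNumber K) • x)
  rw [map_smul] at h1
  simpa using h1

variable {L : Submodule (DualNumber K) (DualExt K V)}

theorem IsLagrangian.toDual_mkQ (hL : IsLagrangian b L) (w : DualExt K V) (y : L) :
    hL.toDual (L.mkQ w) y = extForm b w y := rfl

/-- The form identifies `(V ⊕ εV)/L` with the dual of a Lagrangian submodule `L`. -/
theorem IsLagrangian.toDual_bijective [FiniteDimensional K V] (hs : b.IsSymm)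
    (hb : b.Nondegenerate) (hL : IsLagrangian b L) : Function.Bijective hL.toDual := by
  have hnd := imForm_nondegenerate hs hb
  constructor
  · rw [← LinearMap.ker_eq_bot, LinearMap.ker_eq_bot']
    intro x hx
    obtain ⟨w, rfl⟩ := L.mkQ_surjective x
    have hle : L.restrictScalars K ≤ (imForm b).orthogonal (L.restrictScalars K) := by
      intro x hx
      rw [LinearMap.BilinForm.mem_orthogonal_iff]
      intro y hy
      rw [← snd_extForm, hL.isotropic y hy x hx]
      rfl
    have hfin : Module.finrank K (L.restrictScalars K) = Module.finrank K V := hL.finrank_eq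
    -- `L` is isotropic of half the dimension, hence equal to its orthogonal.
    have heq := Submodule.eq_of_le_of_finrank_eq hle (by
      rw [LinearMap.BilinForm.finrank_orthogonal hnd, finrank_dualExt, hfin]
      omega)
    have hw : w ∈ (imForm b).orthogonal (L.restrictScalars K) := by
      rw [LinearMap.BilinForm.mem_orthogonal_iff]
      intro y hy
      have h1 := DFunLike.congr_fun hx ⟨y, hy⟩
      rw [hL.toDual_mkQ] at h1
      rw [imForm_comm hs, ← snd_extForm, h1]
      rfl
    rw [← heq] at hw
    exact (Submodule.Quotient.mk_eq_zero L).2 hw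
  · intro ψ
    -- Only the `ε`-component of `ψ` matters: extend it from `L` to a `K`-functional and represent
    -- that by the non-degenerate `imForm b`.
    obtain ⟨l, hl⟩ := LinearMap.exists_extend (p := L.restrictScalars K)
      (TrivSqZeroExt.sndHom K K ∘ₗ ψ.restrictScalars K)
    refine ⟨L.mkQ (((imForm b).toDual hnd).symm l), ?_⟩
    rw [← sub_eq_zero]
    refine dual_eq_zero_of_snd_eq_zero _ fun y => ?_
    rw [LinearMap.sub_apply, hL.toDual_mkQ, TrivSqZeroExt.snd_sub, snd_extForm,
      ← LinearMap.BilinForm.toDual_def hnd, LinearEquiv.apply_symm_apply, sub_eq_zero]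
    exact DFunLike.congr_fun hl y

variable {C : Submodule K (DualExt K V)}

/-- An isomorphism of modules preserves `φ₀ = 0`. Skewness may be tested on `ε`-components, since
for fixed `y` the sum `ψ x y + ψ y x` is `K[ε]`-linear in `x`. -/
theorem mem_homZeroSkew_iff [FiniteDimensional K V] (hs : b.IsSymm) (hb : b.Nondegenerate)
    (hL : IsLagrangian b L) {φ : L →ₗ[DualNumber K] DualExt K V ⧸ L}
    {φ' : L.restrictScalars K →ₗ[K] C}
    (h : forgetHom L φ = (L.restrictScalars K).mkQ ∘ₗ C.subtype ∘ₗ φ') :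
    hL.toDual ∘ₗ φ ∈ homZeroSkew K L ↔ IsRankTangent φ' ∧ IsSkewTangent (imForm b) φ' := by
  have hbij := hL.toDual_bijective hs hb
  rw [← inducedZero_eq_zero_iff h, and_comm]
  rw [forgetHom_eq_iff] at h
  have hval : ∀ x y : L, (hL.toDual ∘ₗ φ) x y = extForm b (φ' x) y := by
    intro x y
    rw [LinearMap.comp_apply, h x x.2]
    rfl
  refine and_congr ?_ ?_
  · constructor
    · intro H x y
      have h1 := ((hval x y).symm.trans (H x y)).trans (congrArg Neg.neg (hval y x))
      have h2 := congrArg TrivSqZeroExt.snd h1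
      rw [TrivSqZeroExt.snd_neg, snd_extForm, snd_extForm] at h2
      rw [h2, imForm_comm hs x]
      exact neg_add_cancel _
    · intro H x y
      let ψ := hL.toDual ∘ₗ φ
      have h1 : ψ.flip y + ψ y = 0 := dual_eq_zero_of_snd_eq_zero _ fun z => by
        rw [LinearMap.add_apply, LinearMap.flip_apply, hval, hval, TrivSqZeroExt.snd_add,
          snd_extForm, snd_extForm, imForm_comm hs (φ' y)]
        exact H z y
      have h2 := DFunLike.congr_fun h1 x
      exact eq_neg_of_add_eq_zero_left h2
  · rw [mem_homZero_iff, mem_homZero_iff]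
    refine forall₂_congr fun x hx => ?_
    rw [hbij.2.exists]
    refine exists_congr fun y => ?_
    rw [← map_smul, LinearMap.comp_apply]
    exact hbij.1.eq_iff

theorem mem_oGr_iff {L : Submodule K (DualExt K V)} : L ∈ oGr b ↔
    Module.finrank K L = Module.finrank K V ∧ ∀ x ∈ L, ∀ y ∈ L, imForm b x y = 0 := by
  simp only [← snd_extForm]
  rfl

end Form

/-! ### Components of the orthogonal Grassmannian -/

section Component

variable {K : Type*} [Field K] {V : Type*} [AddCommGroup V] [Module K V]
  {b : LinearMap.BilinForm K V}

theorem oGrComponent_subset (m : Fin 2) : oGrComponent b m ⊆ oGr b := by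
  unfold oGrComponent
  split_ifs
  · exact @connectedComponentIn_subset _ (grTopology K (DualExt K V)) _ _
  · exact Set.sdiff_subset

/-- For the complement of the component the argument runs backwards: if `L'` were in the component
of `[εV]`, so would be `L`. -/
theorem mem_oGrComponent_of_isPreconnected {m : Fin 2} {s : Set (Submodule K (DualExt K V))}
    (hs : @IsPreconnected _ (grTopology K (DualExt K V)) s) (hsub : s ⊆ oGr b)
    {L L' : Submodule K (DualExt K V)} (hL : L ∈ s) (hL' : L' ∈ s)
    (hm : L ∈ oGrComponent b m) : L' ∈ oGrComponent b m := by
  let _ := grTopology K (DualExt K V)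
  have key : ∀ {M M'}, M ∈ s → M' ∈ s → M ∈ connectedComponentIn (oGr b) (epsV K V) →
      M' ∈ connectedComponentIn (oGr b) (epsV K V) := by
    intro M M' hM hM' h
    rw [connectedComponentIn_eq h]
    exact hs.subset_connectedComponentIn hM hsub hM'
  unfold oGrComponent at hm ⊢
  split_ifs at hm ⊢
  · exact key hL hL' hm
  · exact ⟨hsub hL', fun h => hm.2 (key hL' hL h)⟩

end Component

/-! ### Splittings adapted to a quadratic space -/

section Orthogonal

variable {K : Type*} [Field K] {V : Type*} [AddCommGroup V] [Module K V]

/-- A splitting `V = F ⊕ A ⊕ B` such that `F`, `B` are isotropic and `A` is orthogonal to both. -/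
structure Splitting.IsOrthogonal (D : Splitting K V) (b : LinearMap.BilinForm K V) : Prop where
  FF : ∀ f f' : D.F, b f f' = 0
  BB : ∀ f f' : D.B, b f f' = 0
  FA : ∀ (f : D.F) (a : D.A), b f a = 0
  AF : ∀ (a : D.A) (f : D.F), b a f = 0
  AB : ∀ (a : D.A) (f : D.B), b a f = 0
  BA : ∀ (f : D.B) (a : D.A), b f a = 0

variable {b : LinearMap.BilinForm K V} [FiniteDimensional K V]

/-- A complement of the orthogonal space of `F` is in duality with `F`. -/
theorem exists_mem_of_isCompl_orthogonal (hb : b.Nondegenerate)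
    {F B : Submodule K V} (hB : IsCompl (b.orthogonal F) B) :
    (∀ f ∈ F, (∀ y ∈ B, b f y = 0) → f = 0) ∧
      ∀ l : Module.Dual K B, ∃ f : F, ∀ y : B, b f y = l y := by
  have hinj : ∀ f ∈ F, (∀ y ∈ B, b f y = 0) → f = 0 := by
    intro f hf h
    refine hb.1 f fun v => ?_
    obtain ⟨w, hw, y, hy, rfl⟩ := Submodule.mem_sup.1
      (hB.sup_eq_top ▸ Submodule.mem_top : v ∈ b.orthogonal F ⊔ B)
    rw [map_add, h y hy, LinearMap.BilinForm.mem_orthogonal_iff.1 hw f hf, add_zero]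
  refine ⟨hinj, fun l => ?_⟩
  let Φ : F →ₗ[K] Module.Dual K B := b.domRestrict₁₂ F B
  have hΦ : Function.Injective Φ := by
    rw [← LinearMap.ker_eq_bot, LinearMap.ker_eq_bot']
    intro f hf
    exact Subtype.ext (hinj f f.2 fun y hy => DFunLike.congr_fun hf ⟨y, hy⟩)
  have hdim : Module.finrank K F = Module.finrank K (Module.Dual K B) := by
    rw [Subspace.dual_finrank_eq]
    have h1 := Submodule.finrank_add_eq_of_isCompl hB
    rw [LinearMap.BilinForm.finrank_orthogonal hb] at h1
    have h2 := F.finrank_le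
    omega
  obtain ⟨f, hf⟩ := (LinearMap.injective_iff_surjective_of_finrank_eq_finrank hdim).1 hΦ l
  exact ⟨f, fun y => DFunLike.congr_fun hf y⟩

/-- The orthogonal space of an isotropic subspace has an isotropic complement. -/
theorem exists_isotropic_isCompl (h2 : (2 : K) ≠ 0) (hs : b.IsSymm) (hb : b.Nondegenerate)
    {F : Submodule K V} (hF : F ≤ b.orthogonal F) :
    ∃ B, IsCompl (b.orthogonal F) B ∧ ∀ x ∈ B, ∀ y ∈ B, b x y = 0 := by
  obtain ⟨B₀, hB₀⟩ := (b.orthogonal F).exists_isCompl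
  obtain ⟨hinj, hsurj⟩ := exists_mem_of_isCompl_orthogonal hb hB₀
  -- `τ x ∈ F` represents `b x` on `B₀`, and is unique because `F` pairs faithfully with `B₀`.
  choose τ hτ using fun x : B₀ => hsurj ((b x).domRestrict B₀)
  have hτ' : ∀ x y : B₀, b (τ x) y = b x y := fun x y => hτ x y
  have hlin : ∀ x y : B₀, τ (x + y) = τ x + τ y := fun x y => by
    rw [← sub_eq_zero]
    refine Subtype.ext (hinj _ (Subtype.prop _) fun z hz => ?_)
    have h1 := hτ' (x + y) ⟨z, hz⟩
    have h2 := hτ' x ⟨z, hz⟩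
    have h3 := hτ' y ⟨z, hz⟩
    simp at h1 h2 h3 ⊢
    rw [h1, h2, h3]
    ring
  have hsm : ∀ (c : K) (x : B₀), τ (c • x) = c • τ x := fun c x => by
    rw [← sub_eq_zero]
    refine Subtype.ext (hinj _ (Subtype.prop _) fun z hz => ?_)
    have h1 := hτ' (c • x) ⟨z, hz⟩
    have h2 := hτ' x ⟨z, hz⟩
    simp at h1 h2 ⊢
    rw [h1, h2]
    ring
  let T : B₀ →ₗ[K] F := { toFun := τ, map_add' := hlin, map_smul' := hsm }
  -- Subtracting half of `τ x` makes `B₀` isotropic: both cross terms equal `½ b(x, y)` and `F`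
  -- contributes nothing.
  let σ : B₀ →ₗ[K] V := B₀.subtype - (2⁻¹ : K) • (F.subtype ∘ₗ T)
  have hσ : ∀ x : B₀, σ x = x - (2⁻¹ : K) • (τ x : V) := fun x => rfl
  have hFF : ∀ f f' : F, b f f' = 0 := fun f f' =>
    LinearMap.BilinForm.mem_orthogonal_iff.1 (hF f'.2) f f.2
  refine ⟨LinearMap.range σ, ⟨?_, ?_⟩, ?_⟩
  · rw [Submodule.disjoint_def]
    rintro _ hx ⟨x, rfl⟩
    rw [hσ] at hx ⊢
    have h3 : (x : V) ∈ b.orthogonal F := by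
      have := (b.orthogonal F).add_mem hx ((b.orthogonal F).smul_mem (2⁻¹ : K) (hF (τ x).2))
      simpa using this
    have h4 : x = 0 := Subtype.ext (Submodule.disjoint_def.1 hB₀.disjoint x h3 x.2)
    rw [← hσ, h4, map_zero]
  · rw [codisjoint_iff, eq_top_iff]
    intro v _
    obtain ⟨w, hw, y, hy, rfl⟩ := Submodule.mem_sup.1
      (hB₀.sup_eq_top ▸ Submodule.mem_top : v ∈ b.orthogonal F ⊔ B₀)
    refine Submodule.mem_sup.2 ⟨w + (2⁻¹ : K) • (τ ⟨y, hy⟩ : V),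
      (b.orthogonal F).add_mem hw ((b.orthogonal F).smul_mem _ (hF (τ ⟨y, hy⟩).2)), _,
      ⟨⟨y, hy⟩, rfl⟩, ?_⟩
    rw [hσ]
    simp
  · rintro _ ⟨x, rfl⟩ _ ⟨y, rfl⟩
    rw [hσ, hσ]
    simp only [map_sub, map_smul, LinearMap.sub_apply, LinearMap.smul_apply, smul_eq_mul, hFF,
      hs.eq (x : V) (τ y), hτ', hs.eq (y : V) x]
    field_simp
    ring

/-- Take `A = F^⊥ ∩ B^⊥`. A vector of `F^⊥` is moved into `A` by subtracting the element of `F` that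
has the same pairing with `B`. -/
theorem exists_orthogonal_splitting (h2 : (2 : K) ≠ 0) (hs : b.IsSymm) (hb : b.Nondegenerate)
    {F : Submodule K V} (hF : F ≤ b.orthogonal F) :
    ∃ D : Splitting K V, D.F = F ∧ D.F ⊔ D.A = b.orthogonal F ∧ D.IsOrthogonal b := by
  obtain ⟨B, hB, hBB⟩ := exists_isotropic_isCompl h2 hs hb hF
  obtain ⟨hinj, hsurj⟩ := exists_mem_of_isCompl_orthogonal hb hB
  let A := b.orthogonal F ⊓ b.orthogonal B
  have hFA : Disjoint F A := by
    rw [Submodule.disjoint_def]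
    intro f hf hfA
    refine hinj f hf fun y hy => ?_
    rw [hs.eq]
    exact LinearMap.BilinForm.mem_orthogonal_iff.1 hfA.2 y hy
  have hsup : F ⊔ A = b.orthogonal F := by
    refine le_antisymm (sup_le hF inf_le_left) fun v hv => ?_
    obtain ⟨f, hf⟩ := hsurj ((b v).domRestrict B)
    refine Submodule.mem_sup.2 ⟨f, f.2, v - f, ⟨Submodule.sub_mem _ hv (hF f.2), ?_⟩, by abel⟩
    change _ ∈ b.orthogonal B
    rw [LinearMap.BilinForm.mem_orthogonal_iff]
    intro y hy
    have := hf ⟨y, hy⟩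
    rw [LinearMap.domRestrict_apply] at this
    rw [map_sub, hs.eq y v, hs.eq y f, this, sub_self]
  have hAF : ∀ f ∈ F, ∀ a ∈ A, b f a = 0 := fun f hf a ha =>
    LinearMap.BilinForm.mem_orthogonal_iff.1 ha.1 f hf
  have hBA : ∀ f ∈ B, ∀ a ∈ A, b f a = 0 := fun f hf a ha =>
    LinearMap.BilinForm.mem_orthogonal_iff.1 ha.2 f hf
  refine ⟨Splitting.ofIsCompl F A B hFA (by rwa [hsup]), rfl, hsup, ⟨?_, ?_, ?_, ?_, ?_, ?_⟩⟩
  · exact fun f f' => LinearMap.BilinForm.mem_orthogonal_iff.1 (hF f'.2) f f.2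
  · exact fun f f' => hBB f f.2 f' f'.2
  · exact fun f a => hAF f f.2 a a.2
  · exact fun a f => (hs.eq _ _).trans (hAF f f.2 a a.2)
  · exact fun a f => (hs.eq _ _).trans (hBA f f.2 a a.2)
  · exact fun f a => hBA f f.2 a a.2

/-- The flag of an `ε`-stable point of the orthogonal Grassmannian. -/
theorem FlagHom.isotropic_of_mem_oGr (hb : b.Nondegenerate) {x : FlagHom K V}
    (hx : x.toSubmodule ∈ oGr b) : x.F ≤ b.orthogonal x.F ∧ x.G = b.orthogonal x.F := by
  rw [mem_oGr_iff] at hx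
  have hle : x.G ≤ b.orthogonal x.F := by
    intro g hg
    rw [LinearMap.BilinForm.mem_orthogonal_iff]
    intro f hf
    rw [← x.epsPart_toSubmodule, mem_epsPart] at hg
    rw [← x.map_projV_toSubmodule] at hf
    obtain ⟨w, hw, rfl⟩ := hf
    have h1 := hx.2 w hw _ hg
    rw [← pairMap_projV_imV w, imForm_pairMap] at h1
    simpa using h1
  have heq : x.G = b.orthogonal x.F := by
    -- Here `dim F + dim G = dim L = dim V`.
    refine Submodule.eq_of_le_of_finrank_eq hle ?_
    have h1 := finrank_eq_stratumIndex_add x.toSubmodule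
    rw [stratumIndex, x.map_projV_toSubmodule, x.epsPart_toSubmodule, hx.1] at h1
    rw [LinearMap.BilinForm.finrank_orthogonal hb]
    omega
  exact ⟨x.le.trans hle, heq⟩

end Orthogonal

/-! ### The largest stratum of the orthogonal variety -/

namespace Splitting

variable {K : Type*} [Field K] {V : Type*} [AddCommGroup V] [Module K V] (D : Splitting K V)
  (ψ₀ : D.F →ₗ[K] D.B) (b : LinearMap.BilinForm K V)

/-- The linear space parametrising the isotropic subspaces in a chart. -/
def skewParam : Submodule K (BundleParam D.F D.A D.B) where
  carrier := {u | (∀ f f' : D.F, b f (u.2.1 f') + b (u.2.1 f) f' = 0) ∧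
    (∀ f f' : D.F, b f (u.2.2.2 f') + b (u.2.2.2 f) f' = 0) ∧
    ∀ (f : D.F) (a : D.A), b f (u.2.2.1 a) + b (u.1 f) a = 0}
  zero_mem' := by simp
  add_mem' := by
    rintro u v ⟨h1, h2, h3⟩ ⟨h1', h2', h3'⟩
    refine ⟨fun f f' => ?_, fun f f' => ?_, fun f f' => ?_⟩
    · have := congrArg₂ (· + ·) (h1 f f') (h1' f f')
      simp at this ⊢
      rw [← this]; ring
    · have := congrArg₂ (· + ·) (h2 f f') (h2' f f')
      simp at this ⊢
      rw [← this]; ring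
    · have := congrArg₂ (· + ·) (h3 f f') (h3' f f')
      simp at this ⊢
      rw [← this]; ring
  smul_mem' := by
    rintro c u ⟨h1, h2, h3⟩
    refine ⟨fun f f' => ?_, fun f f' => ?_, fun f f' => ?_⟩
    · simpa [mul_add] using congrArg (c * ·) (h1 f f')
    · simpa [mul_add] using congrArg (c * ·) (h2 f f')
    · simpa [mul_add] using congrArg (c * ·) (h3 f f')

/-- The substitution `q ↦ q + c s p` of the parameters. -/
def shear (c : K) (u : BundleParam D.F D.A D.B) : BundleParam D.F D.A D.B :=
  u + (0, c • (u.2.2.1 ∘ₗ u.1), 0, 0)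

@[simp] theorem shear_fst (c : K) (u : BundleParam D.F D.A D.B) : (D.shear c u).1 = u.1 := by
  simp [shear]

@[simp] theorem shear_snd (c : K) (u : BundleParam D.F D.A D.B) :
    (D.shear c u).2.1 = u.2.1 + c • (u.2.2.1 ∘ₗ u.1) := by
  simp [shear]

@[simp] theorem shear_trd (c : K) (u : BundleParam D.F D.A D.B) :
    (D.shear c u).2.2.1 = u.2.2.1 := by
  simp [shear]

@[simp] theorem shear_fth (c : K) (u : BundleParam D.F D.A D.B) :
    (D.shear c u).2.2.2 = u.2.2.2 := by
  simp [shear]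

theorem shear_shear {c d : K} (h : c + d = 0) (u : BundleParam D.F D.A D.B) :
    D.shear c (D.shear d u) = u := by
  refine Prod.ext (by simp) (Prod.ext ?_ (Prod.ext (by simp) (by simp)))
  rw [shear_snd, shear_snd, shear_trd, shear_fst, add_assoc, ← add_smul, add_comm d, h, zero_smul,
    add_zero]

/-! ### Isotropy in the sheared parameters -/

variable {D b}

/-- Only the pairings `F × B` and `A × A` survive. The right side is grouped by the blocks of the
pair `(x, y)`. -/
theorem imForm_mat (hD : D.IsOrthogonal b) (u : BundleParam D.F D.A D.B)
    (x y : D.F × D.F × D.A) :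
    imForm b (D.toL ψ₀ x + D.toC (D.mat ψ₀ u x)) (D.toL ψ₀ y + D.toC (D.mat ψ₀ u y)) =
      (b x.1 (u.2.2.2 y.1) + b (u.2.2.2 x.1) y.1) +
      (b x.1 (u.2.1 y.2.1) - b x.1 (u.2.2.1 (u.1 y.2.1)) + b (u.2.1 x.1) y.2.1) +
      (b (u.2.1 x.2.1) y.1 - b (u.2.2.1 (u.1 x.2.1)) y.1 + b x.2.1 (u.2.1 y.1)) +
      (b x.1 (u.2.2.1 y.2.2) + b (u.1 x.1) y.2.2) +
      (b (u.2.2.1 x.2.2) y.1 + b x.2.2 (u.1 y.1)) := by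
  rw [toL_apply, toC_apply, toL_apply, toC_apply, ← map_add, ← map_add, imForm_pairMap,
    mat_apply, mat_apply]
  simp [hD.FF, hD.BB, hD.FA, hD.AF, hD.AB, hD.BA]
  ring

theorem imForm_lin (hD : D.IsOrthogonal b) (w : BundleParam D.F D.A D.B)
    (x y : D.F × D.F × D.A) :
    imForm b (D.toC (D.lin w x)) (D.toL ψ₀ y) =
      b (w.1 x.1) y.2.2 + b (w.2.1 x.1) y.2.1 + b (w.2.2.2 x.1) y.1 + b (w.2.1 x.2.1) y.1 +
        b (w.2.2.1 x.2.2) y.1 := by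
  rw [toL_apply, toC_apply, imForm_pairMap, lin_apply]
  simp [hD.BB, hD.AF, hD.AB, hD.BA]
  ring

/-- The relation between `s` and `p` makes `b(f, s (p g))` symmetric in `f` and `g`. Isotropy asks
that the symmetrisation of `b(f, q g)` equal this form, which holds when `q` is a skew part plus `½
s p`. -/
theorem isotropic_of_mem_skewParam (h2 : (2 : K) ≠ 0) (hs : b.IsSymm) (hD : D.IsOrthogonal b)
    {u : BundleParam D.F D.A D.B} (hu : u ∈ D.skewParam b) :
    ∀ x ∈ grChart (D.L ψ₀) D.C (D.hom ψ₀ (D.mat ψ₀ (D.shear 2⁻¹ u))),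
      ∀ y ∈ grChart (D.L ψ₀) D.C (D.hom ψ₀ (D.mat ψ₀ (D.shear 2⁻¹ u))), imForm b x y = 0 := by
  obtain ⟨h1, h3, h4⟩ := hu
  intro v hv w hw
  obtain ⟨x, rfl⟩ := (D.mem_grChart_hom ψ₀ _ _).1 hv
  obtain ⟨y, rfl⟩ := (D.mem_grChart_hom ψ₀ _ _).1 hw
  rw [imForm_mat ψ₀ hD]
  have hsp : ∀ f g : D.F, b f (u.2.2.1 (u.1 g)) = b (u.2.2.1 (u.1 f)) g := by
    intro f g
    have e1 := h4 f (u.1 g)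
    have e2 := h4 g (u.1 f)
    rw [hs.eq (u.1 g) (u.1 f)] at e2
    rw [hs.eq _ (g : V)]
    linear_combination e1 - e2
  have hhalf : (2⁻¹ : K) + 2⁻¹ = 1 := by field_simp; norm_num
  have h4' : ∀ (a : D.A) (f : D.F), b (u.2.2.1 a) f + b a (u.1 f) = 0 := fun a f => by
    rw [hs.eq _ (f : V), hs.eq (a : V)]
    exact h4 f a
  have e1 := h1 x.1 y.2.1
  have e2 := h1 x.2.1 y.1
  have e3 := hsp x.1 y.2.1
  have e4 := hsp x.2.1 y.1
  simp only [shear_fst, shear_snd, shear_trd, shear_fth, h3, h4, h4', LinearMap.add_apply,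
    LinearMap.smul_apply, LinearMap.comp_apply, Submodule.coe_add, Submodule.coe_smul, map_add,
    map_smul, smul_eq_mul]
  linear_combination e1 + e2 + (2⁻¹ - 1) * e3 + 2⁻¹ * e4 +
    b (u.2.2.1 (u.1 x.1)) y.2.1 * hhalf + b (u.2.2.1 (u.1 x.2.1)) y.1 * hhalf

/-- Three pairs of basic vectors give the equations for `ψ`, for `q` and for `(s, p)`; removing `½ s
p` makes the one for `q` homogeneous. -/
theorem shear_mem_skewParam (h2 : (2 : K) ≠ 0) (hs : b.IsSymm) (hD : D.IsOrthogonal b)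
    {u : BundleParam D.F D.A D.B}
    (h : ∀ x ∈ grChart (D.L ψ₀) D.C (D.hom ψ₀ (D.mat ψ₀ u)),
      ∀ y ∈ grChart (D.L ψ₀) D.C (D.hom ψ₀ (D.mat ψ₀ u)), imForm b x y = 0) :
    D.shear (-2⁻¹) u ∈ D.skewParam b := by
  have h' : ∀ x y, _ := fun x y => (imForm_mat ψ₀ hD u x y).symm.trans
    (h _ ((D.mem_grChart_hom ψ₀ _ _).2 ⟨x, rfl⟩) _ ((D.mem_grChart_hom ψ₀ _ _).2 ⟨y, rfl⟩))
  have hc1 : ∀ f f' : D.F, b f (u.2.2.2 f') + b (u.2.2.2 f) f' = 0 := fun f f' => by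
    simpa using h' (f, 0, 0) (f', 0, 0)
  have hc2 : ∀ f g : D.F, b f (u.2.1 g) - b f (u.2.2.1 (u.1 g)) + b (u.2.1 f) g = 0 := fun f g => by
    simpa using h' (f, 0, 0) (0, g, 0)
  have hc3 : ∀ (f : D.F) (a : D.A), b f (u.2.2.1 a) + b (u.1 f) a = 0 := fun f a => by
    simpa using h' (f, 0, 0) (0, 0, a)
  have hhalf : (2⁻¹ : K) + 2⁻¹ = 1 := by field_simp; norm_num
  refine ⟨fun f f' => ?_, by simpa using hc1, by simpa using hc3⟩
  have hsp : b f (u.2.2.1 (u.1 f')) = b (u.2.2.1 (u.1 f)) f' := by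
    have e1 := hc3 f (u.1 f')
    have e2 := hc3 f' (u.1 f)
    rw [hs.eq (u.1 f') (u.1 f)] at e2
    rw [hs.eq _ (f' : V)]
    linear_combination e1 - e2
  simp only [shear_snd, LinearMap.add_apply,
    LinearMap.smul_apply, LinearMap.comp_apply, Submodule.coe_add, Submodule.coe_smul, map_add,
    map_smul, smul_eq_mul]
  linear_combination hc2 f f' + 2⁻¹ * hsp - b f (u.2.2.1 (u.1 f')) * hhalf

theorem mem_skewParam_of_isSkewTangent (hs : b.IsSymm) (hD : D.IsOrthogonal b)
    {w : BundleParam D.F D.A D.B}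
    (h : IsSkewTangent (imForm b) (D.hom ψ₀ (D.lin w))) : w ∈ D.skewParam b := by
  have h' : ∀ x y : D.F × D.F × D.A, _ := fun x y => by
    have h1 := h (D.eL ψ₀ x) (D.eL ψ₀ y)
    rw [hom_apply_eL, hom_apply_eL, coe_eL, coe_eL, coe_eC, coe_eC,
      imForm_comm hs (D.toL ψ₀ x), imForm_lin ψ₀ hD, imForm_lin ψ₀ hD] at h1
    exact h1
  refine ⟨fun f f' => ?_, fun f f' => ?_, fun f a => ?_⟩
  · have := h' (f, 0, 0) (0, f', 0)
    simp at this
    rw [hs.eq]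
    linear_combination this
  · have := h' (f, 0, 0) (f', 0, 0)
    simp at this
    rw [hs.eq]
    linear_combination this
  · have := h' (f, 0, 0) (0, 0, a)
    simp at this
    rw [hs.eq]
    linear_combination this

theorem mat_shear_base_add_smul (c : K) (w : BundleParam D.F D.A D.B) (t : K) :
    D.mat ψ₀ (D.shear c (D.base ψ₀ + t • w)) = t • D.lin w + t ^ 2 •
      (D.lin (0, c • (w.2.2.1 ∘ₗ w.1), 0, 0) + D.quad (w.2.2.1 ∘ₗ w.1)) := by
  have h : (D.base ψ₀ + t • w).2.2.1 ∘ₗ (D.base ψ₀ + t • w).1 = t ^ 2 • (w.2.2.1 ∘ₗ w.1) := by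
    ext x
    simp [base, smul_smul, pow_two]
  have h3 : D.shear c (D.base ψ₀ + t • w) - D.base ψ₀ =
      t • w + t ^ 2 • ((0, c • (w.2.2.1 ∘ₗ w.1), 0, 0) : BundleParam D.F D.A D.B) := by
    rw [shear, h, add_sub_right_comm, add_sub_cancel_left]
    congr 1
    refine Prod.ext (by simp) (Prod.ext ?_ (Prod.ext (by simp) (by simp)))
    exact smul_comm _ _ _
  rw [mat, shear_trd, shear_fst, h, h3]
  simp only [map_add, map_smul, smul_add]
  abel

variable [FiniteDimensional K V]

theorem isPolyMap_shear (c : K) : IsPolyMap K (D.shear c) := by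
  have h1 : IsPolyMap K fun u : BundleParam D.F D.A D.B => u := IsPolyMap.linear LinearMap.id
  let j : (D.F →ₗ[K] D.B) →ₗ[K] BundleParam D.F D.A D.B :=
    LinearMap.inr K _ _ ∘ₗ LinearMap.inl K _ _ ∘ₗ (c • LinearMap.id)
  exact h1.add ((D.isPolyMap_comp_parts LinearMap.id).linear_comp j)

/-- In the chart, `OΣ^(m)` is the image of the linear space `skewParam` under the sheared
parametrisation. -/
theorem exists_chart_oSigma [Infinite K] (h2 : (2 : K) ≠ 0) (hs : b.IsSymm)
    (hD : D.IsOrthogonal b) {m : Fin 2} (hL : D.L ψ₀ ∈ oSigmaLargestStratum b m) :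
    ∃ C : Submodule K (DualExt K V), IsCompl (D.L ψ₀) C ∧
      ∃ h : (0 : D.L ψ₀ →ₗ[K] C) ∈ grChart (D.L ψ₀) C ⁻¹' oSigma b m,
        IsSmoothPoint K (⟨0, h⟩ : grChart (D.L ψ₀) C ⁻¹' oSigma b m) ∧
        ∀ φ : D.L ψ₀ →ₗ[K] C, IsEpsTangent φ → IsRankTangent φ → IsSkewTangent (imForm b) φ →
          φ ∈ affineTangentSpace K (⟨0, h⟩ : grChart (D.L ψ₀) C ⁻¹' oSigma b m) := by
  obtain ⟨i, ⟨⟨hLm, hLε⟩, hLi⟩, hmax⟩ := hL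
  have hLo := mem_oGr_iff.1 (oGrComponent_subset m hLm)
  have h0 : (0 : D.L ψ₀ →ₗ[K] D.C) ∈ grChart (D.L ψ₀) D.C ⁻¹' oSigma b m := by
    rw [Set.mem_preimage, grChart_zero]
    exact ⟨hLm, hLε⟩
  have hn := D.finrank_grChart_hom ψ₀ (D.mat ψ₀ (D.base ψ₀))
  have hi := D.stratumIndex_grChart_mat ψ₀ (D.base ψ₀)
  have hiso := hLo.2
  rw [mat_base, map_zero, grChart_zero] at hn hi
  rw [hLi] at hi
  rw [hLo.1] at hn
  have hhalf : (2⁻¹ : K) + -2⁻¹ = 0 := add_neg_cancel _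
  have hbase : D.base ψ₀ ∈ D.skewParam b := by
    have h3 := shear_mem_skewParam ψ₀ (u := D.base ψ₀) h2 hs hD (by
      rw [mat_base, map_zero, grChart_zero]
      exact hiso)
    have h4 : D.shear (-2⁻¹) (D.base ψ₀) = D.base ψ₀ := by simp [shear, base]
    rwa [h4] at h3
  have hoGr : ∀ u ∈ D.skewParam b,
      grChart (D.L ψ₀) D.C (D.hom ψ₀ (D.mat ψ₀ (D.shear 2⁻¹ u))) ∈ oGr b := fun u hu =>
    mem_oGr_iff.2 ⟨by rw [finrank_grChart_hom, hn], isotropic_of_mem_skewParam ψ₀ h2 hs hD hu⟩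
  -- The line from `D.base ψ₀` to `u` in `skewParam` becomes a quadratic curve of isotropic
  -- subspaces starting at the centre, so its other end lies in the same `OGr^(m)`.
  have hmem : ∀ u ∈ D.skewParam b,
      grChart (D.L ψ₀) D.C (D.hom ψ₀ (D.mat ψ₀ (D.shear 2⁻¹ u))) ∈ oSigma b m := by
    intro u hu
    refine ⟨?_, D.isEpsStable_grChart_mat ψ₀ _⟩
    have hcurve : ∀ t : K, D.hom ψ₀ (D.mat ψ₀ (D.shear 2⁻¹ (D.base ψ₀ + t • (u - D.base ψ₀)))) =
        0 + t • _ + t ^ 2 • _ := fun t => by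
      rw [mat_shear_base_add_smul, map_add, map_smul, map_smul, zero_add]
    have hconn := isPreconnected_range_grChart_curve (D.isCompl_L_C ψ₀) 0
      (D.hom ψ₀ (D.lin (u - D.base ψ₀)))
      (D.hom ψ₀ (D.lin (0, (2⁻¹ : K) • ((u - D.base ψ₀).2.2.1 ∘ₗ (u - D.base ψ₀).1), 0, 0) +
        D.quad ((u - D.base ψ₀).2.2.1 ∘ₗ (u - D.base ψ₀).1)))
    refine mem_oGrComponent_of_isPreconnected hconn ?_ ⟨0, ?_⟩ ⟨1, ?_⟩ hLm
    · rintro _ ⟨t, rfl⟩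
      dsimp only
      rw [← hcurve]
      exact hoGr _ (Submodule.add_mem _ hbase
        (Submodule.smul_mem _ _ (Submodule.sub_mem _ hu hbase)))
    · dsimp only
      rw [zero_smul, zero_pow two_ne_zero, zero_smul, add_zero, add_zero, grChart_zero]
    · dsimp only
      rw [← hcurve, one_smul, add_sub_cancel]
  refine ⟨D.C, D.isCompl_L_C ψ₀, h0, ?_, ?_⟩
  · refine isSmoothPoint_of_parametrization_submodule (D.skewParam b)
      ((D.isPolyMap_mat ψ₀).comp (isPolyMap_shear 2⁻¹))
      ((isPolyMap_shear (-2⁻¹)).comp (D.isPolyMap_read ψ₀)) (fun u _ => ?_) ?_ _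
    · rw [LinearEquiv.symm_apply_apply, read_mat, shear_shear D (neg_add_cancel _)]
    · ext φ
      constructor
      · intro hφ
        obtain ⟨μ, rfl⟩ := (D.hom ψ₀).surjective φ
        -- Maximality of the stratum bounds the index from above, semicontinuity in the chart from
        -- below.
        have hidx : stratumIndex (grChart (D.L ψ₀) D.C (D.hom ψ₀ μ)) = Module.finrank K D.F :=
          le_antisymm (hi ▸ hmax _ ⟨_, hφ, rfl⟩) (D.finrank_F_le_stratumIndex ψ₀ μ)
        have hμ := D.exists_mat_eq ψ₀ hφ.2 hidx
        have hφo := (mem_oGr_iff.1 (oGrComponent_subset m hφ.1)).2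
        rw [hμ] at hφo
        refine ⟨_, shear_mem_skewParam ψ₀ h2 hs hD hφo, ?_⟩
        dsimp only
        rw [shear_shear D (add_neg_cancel _), ← hμ]
      · rintro ⟨u, hu, rfl⟩
        exact hmem u hu
  · intro φ hE hR hS
    obtain ⟨μ, rfl⟩ := (D.hom ψ₀).surjective φ
    have hμ := D.eq_lin_of_isTangent ψ₀ hE hR
    rw [hμ] at hS
    have hw := mem_skewParam_of_isSkewTangent ψ₀ hs hD hS
    refine mem_affineTangentSpace_of_curve _ _ (D.hom ψ₀ (D.lin
      (0, (2⁻¹ : K) • ((D.read μ).2.2.1 ∘ₗ (D.read μ).1), 0, 0) +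
        D.quad ((D.read μ).2.2.1 ∘ₗ (D.read μ).1))) fun t => ?_
    have := hmem _ (Submodule.add_mem _ hbase (Submodule.smul_mem _ t hw))
    rw [mat_shear_base_add_smul, ← hμ, map_add, map_smul, map_smul] at this
    rw [zero_add]
    exact this

end Splitting

/-- Smoothness and tangent spaces of the orthogonal variety along its largest stratum. -/
theorem isGrSmoothPoint_and_grTangentSpace_oSigma {K : Type*} [Field K] [Infinite K]
    (h2 : (2 : K) ≠ 0) {V : Type*} [AddCommGroup V] [Module K V] [FiniteDimensional K V]
    {b : LinearMap.BilinForm K V} (hs : b.IsSymm) (hb : b.Nondegenerate) {m : Fin 2}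
    {L : Submodule (DualNumber K) (DualExt K V)} (hL : IsLagrangian b L)
    (hLm : L.restrictScalars K ∈ oSigmaLargestStratum b m) :
    IsGrSmoothPoint (oSigma b m) (L.restrictScalars K) ∧
      grTangentSpace (oSigma b m) (L.restrictScalars K) =
        forgetHom L '' {φ | hL.toDual ∘ₗ φ ∈ homZeroSkew K L} := by
  obtain ⟨i, ⟨⟨hLc, hLε⟩, hLi⟩, hmax⟩ := id hLm
  obtain ⟨x, hx⟩ := hLε.exists_flagHom
  obtain ⟨hF, hG⟩ := x.isotropic_of_mem_oGr hb (hx ▸ oGrComponent_subset m hLc)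
  obtain ⟨D, hDF, hDG, hD⟩ := exists_orthogonal_splitting h2 hs hb hF
  obtain ⟨ψ₀, hψ⟩ := D.exists_eq_toSubmodule x hDF (hDG.trans hG.symm)
  rw [hx] at hψ
  have key := D.exists_chart_oSigma ψ₀ h2 hs hD (m := m)
  rw [hψ] at key
  obtain ⟨C, hC, h0, hsm, key⟩ := key hLm
  refine ⟨⟨C, hC, h0, hsm⟩, ?_⟩
  ext ξ
  constructor
  · rintro ⟨C, hC, h0, φ', hφ', rfl⟩
    obtain ⟨φ, hφ⟩ := exists_forgetHom_eq (isEpsTangent_of_mem hC hφ' fun L' h => h.2)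
    refine ⟨φ, (mem_homZeroSkew_iff hs hb hL hφ).2 ⟨?_, ?_⟩, hφ⟩
    · exact isRankTangent_of_mem hφ' fun L' h => hLi.symm ▸ hmax _ ⟨L', h, rfl⟩
    · exact isSkewTangent_of_mem _ hφ' fun L' h =>
        (mem_oGr_iff.1 (oGrComponent_subset m h.1)).2
  · rintro ⟨φ, hφ, rfl⟩
    obtain ⟨φ', hφ'⟩ := exists_lift_of_isCompl hC (forgetHom L φ)
    have h := (mem_homZeroSkew_iff hs hb hL hφ').1 hφ
    exact ⟨C, hC, h0, φ', key φ' (isEpsTangent_of_forgetHom_eq hφ') h.1 h.2, hφ'⟩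

end DualHecke

end

theorem mainTheorem7 (K : Type*) [Field K] [IsAlgClosed K] (hchar : (2 : K) ≠ 0)
    (V : Type*) [AddCommGroup V] [Module K V] [FiniteDimensional K V] :
    (∀ (b : LinearMap.BilinForm K V), b.IsSymm → b.Nondegenerate →
      ∀ (m : Fin 2) (L : Submodule (DualNumber K) (DualHecke.DualExt K V))
        (hL : DualHecke.IsLagrangian b L),
        L.restrictScalars K ∈ DualHecke.oSigmaLargestStratum b m →
          DualHecke.IsGrSmoothPoint (DualHecke.oSigma b m) (L.restrictScalars K) ∧
          Function.Bijective hL.toDual ∧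
          DualHecke.grTangentSpace (DualHecke.oSigma b m) (L.restrictScalars K) =
            DualHecke.forgetHom L '' {φ | hL.toDual ∘ₗ φ ∈ DualHecke.homZeroSkew K L}) ∧
    (∀ n i : ℕ,
      (∀ L : Submodule (DualNumber K) (DualHecke.DualExt K V),
        L.restrictScalars K ∈ DualHecke.sigmaStratum K V n i →
          DualHecke.grTangentSpace (DualHecke.sigmaStratum K V n i) (L.restrictScalars K) =
            DualHecke.forgetHom L '' DualHecke.homZero K L (DualHecke.DualExt K V ⧸ L)) ∧
      DualHecke.FlagHom.toSubmodule '' DualHecke.flagBundle K V n i =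
        DualHecke.sigmaStratum K V n i ∧
      DualHecke.IsBundleEmbedding K V n i) := by
  refine ⟨fun b hs hb m L hL hLm => ?_, fun n i => ⟨DualHecke.grTangentSpace_sigmaStratum,
    DualHecke.image_flagBundle n i, DualHecke.isBundleEmbedding n i⟩⟩
  have h := DualHecke.isGrSmoothPoint_and_grTangentSpace_oSigma hchar hs hb hL hLm
  exact ⟨h.1, hL.toDual_bijective hs hb, h.2⟩
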